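/- Let $N\ge 2$ and let $\Omega\subset\mathbb R^N$ be a bounded $(\epsilon,\delta)$-domain: $\Omega$ is open and connected, $\epsilon,\delta>0$, and any $x,y\in\Omega$ with $|x-y|<\delta$ can be joined by a rectifiable arc $\gamma\subset\Omega$ of length at most $|x-y|/\epsilon$ such that $\operatorname{dist}(z,\Omega^c)\ge \epsilon|x-z||y-z|/|x-y|$ for every $z\in\gamma$. Assume that $\Omega=\bigcup_n\Omega_n$ for an increasing sequence of bounded Lipschitz domains $\Omega_n$. Let $1<p<N$ and $N-p<d<N$, and assume that the boundary $\Gamma:=\partial\Omega$ is a $d$-set with respect to a Borel measure $\mu$ with support $\Gamma$, i.e. there are $c_1,c_2>0$ with $c_1r^d\le\mu(B(x,r)\cap\Gamma)\le c_2r^d$ for all $x\in\Gamma$ and $0<r\le1$. Let $1<q<d$, $s,\eta\in(0,1)$, $s>(N-d)/p$, and $$p\ge\frac{2N}{N+2s},\qquad q\ge\frac{2d}{d+2\eta}.$$ Write $$\mathfrak N_\Omega^p(u)=\int_\Omega\int_\Omega\frac{|u(x)-u(y)|^p}{|x-y|^{N+sp}}\,dx\,dy,\qquad \mathfrak N_\Gamma^q(w)=\int_\Gamma\int_\Gamma\frac{|w(x)-w(y)|^q}{|x-y|^{d+\eta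 q}}\,d\mu_x\,d\mu_y,$$ $W^{s,p}(\Omega)=\{u\in L^p(\Omega):\mathfrak N^p_\Omega(u)<\infty\}$ and $\mathbb B^q_\eta(\Gamma)=\{w\in L^q_\mu(\Gamma):\mathfrak N_\Gamma^q(w)<\infty\}$. Let $\mathbb W_{p,q}(\Omega,\Gamma)$ be the set of all $u\in W^{s,p}(\Omega)$ whose trace $u|_\Gamma$ belongs to $\mathbb B^q_\eta(\Gamma)$, where $$u|_\Gamma(x)=\lim_{r\to0^+}\frac1{|B(x,r)\cap\Omega|}\int_{B(x,r)\cap\Omega}u\,dy\qquad\text{for }\mu\text{-a.e. }x\in\Gamma .$$ Define $\Psi:L^2(\Omega)\to[0,\infty]$ by $$\Psi(u)=\begin{cases}\frac1p\,\mathfrak N_\Omega^p(u)+\frac1q\,\mathfrak N_\Gamma^q(u|_\Gamma)&\text{if }u\in\mathbb W_{p,q}(\Omega,\Gamma)\cap L^2(\Omega),\\+\infty&\text{otherwise,}\end{cases}$$ and let $\mathcal A=\partial\Psi$ be its subdifferential in $L^2(\Omega)$: $f\in\mathcal A(u)$ if and only if $\Psi(u)<\infty$ and $\Psi(v)\ge\Psi(u)+\int_\Omega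 f(v-u)\,dx$ for all $v\in L^2(\Omega)$. Let $\mathscr N(\mathcal A)=\{u:0\in\mathcal A(u)\}$ and $\mathscr R(\mathcal A)=\bigcup_u\mathcal A(u)$. Then: 1. $\mathscr N(\mathcal A)$ consists exactly of the (a.e.) constant real functions on $\Omega$; 2. $\mathscr R(\mathcal A)=\{f\in L^2(\Omega):\int_\Omega f\,dx=0\}$; 3. $\mathscr R(\mathcal A)=\mathscr N(\mathcal A)^\perp$, the orthogonal complement being taken in $L^2(\Omega)$. -/

import Mathlib

open Set Filter Topology MeasureTheory
open scoped ENNReal NNReal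

/-! ### Domains and sets -/

/-- An `(ε, δ)`-domain: `Ω` is open and connected, and any `x, y ∈ Ω` with `|x - y| < δ` are joined
inside `Ω` by a curve of length at most `|x - y| / ε` all of whose points `z` have distance at least
`ε |x - z| |y - z| / |x - y|` to the complement of `Ω`. -/
def IsEpsDeltaDomain {N : ℕ} (ε δ : ℝ) (Ω : Set (EuclideanSpace ℝ (Fin N))) : Prop :=
  0 < ε ∧ 0 < δ ∧ IsOpen Ω ∧ IsConnected Ω ∧
  ∀ x ∈ Ω, ∀ y ∈ Ω, ‖x - y‖ < δ →
    ∃ γ : ℝ → EuclideanSpace ℝ (Fin N),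
      ContinuousOn γ (Icc 0 1) ∧ γ 0 = x ∧ γ 1 = y ∧ (∀ t ∈ Icc (0 : ℝ) 1, γ t ∈ Ω) ∧
      eVariationOn γ (Icc 0 1) ≤ ENNReal.ofReal (‖x - y‖ / ε) ∧
      ∀ t ∈ Icc (0 : ℝ) 1,
        ε * ‖x - γ t‖ * ‖y - γ t‖ / ‖x - y‖ ≤ Metric.infDist (γ t) Ωᶜ

/-- A bounded Lipschitz domain: near each boundary point `x`, and with respect to a suitable unit
vector `e` (the vertical direction), the set is the strict epigraph of a Lipschitz function of the
horizontal variables, that is, of a Lipschitz function `φ` that is invariant under translations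
along `e`. -/
def IsBoundedLipschitzDomain {N : ℕ} (U : Set (EuclideanSpace ℝ (Fin N))) : Prop :=
  IsOpen U ∧ IsConnected U ∧ Bornology.IsBounded U ∧
  ∀ x ∈ frontier U, ∃ r : ℝ, 0 < r ∧ ∃ e : EuclideanSpace ℝ (Fin N), ‖e‖ = 1 ∧
    ∃ (φ : EuclideanSpace ℝ (Fin N) → ℝ) (K : ℝ≥0), LipschitzWith K φ ∧
      (∀ (y : EuclideanSpace ℝ (Fin N)) (t : ℝ), φ (y + t • e) = φ y) ∧
      ∀ y ∈ Metric.ball x r, (y ∈ U ↔ φ y < inner ℝ e y)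

/-- `Ω` is the union of an increasing sequence of bounded Lipschitz domains. -/
def IsIncreasingUnionOfLipschitz {N : ℕ} (Ω : Set (EuclideanSpace ℝ (Fin N))) : Prop :=
  ∃ U : ℕ → Set (EuclideanSpace ℝ (Fin N)),
    (∀ n, IsBoundedLipschitzDomain (U n)) ∧ (∀ n, U n ⊆ U (n + 1)) ∧ Ω = ⋃ n, U n

/-- The closed non-empty set `F` is a `d`-set with respect to the Borel measure `μ`
(a `d`-Ahlfors measure on `F`). As usual, the radii range over `(0, 1]`. -/
def IsDSet {N : ℕ} (d : ℝ) (μ : Measure (EuclideanSpace ℝ (Fin N)))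
    (F : Set (EuclideanSpace ℝ (Fin N))) : Prop :=
  IsClosed F ∧ F.Nonempty ∧ 0 < d ∧ d ≤ N ∧ μ.support = F ∧
  ∃ c₁ c₂ : ℝ, 0 < c₁ ∧ 0 < c₂ ∧ ∀ x ∈ F, ∀ r : ℝ, 0 < r → r ≤ 1 →
    ENNReal.ofReal (c₁ * r ^ d) ≤ μ (Metric.ball x r ∩ F) ∧
    μ (Metric.ball x r ∩ F) ≤ ENNReal.ofReal (c₂ * r ^ d)

/-! ### Fractional Sobolev and Besov spaces, traces -/

/-- The `r`-th power of a Gagliardo-type seminorm,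
`∫∫ |u(x) - u(y)|^r / |x - y|^a dν(y) dν(x)`, as a number in `[0, ∞]`. -/
noncomputable def gagliardo {N : ℕ} (ν : Measure (EuclideanSpace ℝ (Fin N))) (r a : ℝ)
    (u : EuclideanSpace ℝ (Fin N) → ℝ) : ℝ≥0∞ :=
  ∫⁻ x, ∫⁻ y, ENNReal.ofReal (|u x - u y| ^ r / ‖x - y‖ ^ a) ∂ν ∂ν

/-- `𝔑_Ω^p(u)`, the `p`-th power of the Gagliardo seminorm of order `s` on `Ω`. -/
noncomputable def interiorEnergy {N : ℕ} (Ω : Set (EuclideanSpace ℝ (Fin N))) (s p : ℝ)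
    (u : EuclideanSpace ℝ (Fin N) → ℝ) : ℝ≥0∞ :=
  gagliardo (volume.restrict Ω) p (N + s * p) u

/-- `𝔑_F^q(w)`, the `q`-th power of the Besov seminorm of order `η` on the `d`-set `F`. -/
noncomputable def besovEnergy {N : ℕ} (F : Set (EuclideanSpace ℝ (Fin N)))
    (μ : Measure (EuclideanSpace ℝ (Fin N))) (d η q : ℝ)
    (w : EuclideanSpace ℝ (Fin N) → ℝ) : ℝ≥0∞ :=
  gagliardo (μ.restrict F) q (d + η * q) w

/-- Membership in the fractional Sobolev space `W^{s,p}(Ω)`. -/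
def MemFracSobolev {N : ℕ} (Ω : Set (EuclideanSpace ℝ (Fin N))) (s p : ℝ)
    (u : EuclideanSpace ℝ (Fin N) → ℝ) : Prop :=
  MemLp u (ENNReal.ofReal p) (volume.restrict Ω) ∧ interiorEnergy Ω s p u < ∞

/-- Membership in the Besov space `𝔹^q_η(F)` on the `d`-set `F` relative to `μ`. -/
def MemBesov {N : ℕ} (F : Set (EuclideanSpace ℝ (Fin N)))
    (μ : Measure (EuclideanSpace ℝ (Fin N))) (d η q : ℝ)
    (w : EuclideanSpace ℝ (Fin N) → ℝ) : Prop :=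
  MemLp w (ENNReal.ofReal q) (μ.restrict F) ∧ besovEnergy F μ d η q w < ∞

/-- `u : Ω → ℝ` has the trace value `a` at `x`: the mean values of `u` over `B(x, r) ∩ Ω` tend to
`a` as `r → 0+`. -/
def HasTraceAt {N : ℕ} (Ω : Set (EuclideanSpace ℝ (Fin N)))
    (u : EuclideanSpace ℝ (Fin N) → ℝ) (x : EuclideanSpace ℝ (Fin N)) (a : ℝ) : Prop :=
  Tendsto (fun r : ℝ => ⨍ y in Metric.ball x r ∩ Ω, u y) (𝓝[>] 0) (𝓝 a)

open Classical in
/-- The trace of `u`, as a function: its trace value wherever there is one (and `0` elsewhere). -/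
noncomputable def traceFun {N : ℕ} (Ω : Set (EuclideanSpace ℝ (Fin N)))
    (u : EuclideanSpace ℝ (Fin N) → ℝ) (x : EuclideanSpace ℝ (Fin N)) : ℝ :=
  if h : ∃ a, HasTraceAt Ω u x a then h.choose else 0

/-- Membership in `𝕎_{p,q}(Ω, Γ)`, `Γ = ∂Ω`: `u ∈ W^{s,p}(Ω)`, and `u` has a trace `μ`-almost
everywhere on `Γ`, which belongs to `𝔹^q_η(Γ)`. -/
def MemWpq {N : ℕ} (Ω : Set (EuclideanSpace ℝ (Fin N)))
    (μ : Measure (EuclideanSpace ℝ (Fin N))) (d s η p q : ℝ)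
    (u : EuclideanSpace ℝ (Fin N) → ℝ) : Prop :=
  MemFracSobolev Ω s p u ∧
  (∀ᵐ x ∂(μ.restrict (frontier Ω)), ∃ a, HasTraceAt Ω u x a) ∧
  MemBesov (frontier Ω) μ d η q (traceFun Ω u)

/-! ### The functional and its subdifferential -/

open Classical in
/-- The functional `Ψ : L²(Ω) → [0, ∞]`, equal to `(1/p) 𝔑_Ω^p(u) + (1/q) 𝔑_Γ^q(u|_Γ)` on
`𝕎_{p,q}(Ω, Γ) ∩ L²(Ω)` and to `∞` elsewhere. -/
noncomputable def Psi {N : ℕ} (Ω : Set (EuclideanSpace ℝ (Fin N)))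
    (μ : Measure (EuclideanSpace ℝ (Fin N))) (d s η p q : ℝ)
    (u : Lp ℝ 2 ((volume : Measure (EuclideanSpace ℝ (Fin N))).restrict Ω)) : ℝ≥0∞ :=
  if MemWpq Ω μ d s η p q u then
    ENNReal.ofReal (1 / p) * interiorEnergy Ω s p u +
      ENNReal.ofReal (1 / q) * besovEnergy (frontier Ω) μ d η q (traceFun Ω u)
  else ∞

/-- The subdifferential of `φ : H → [0, ∞]` on a real Hilbert space `H`, as a set-valued operator:
`f ∈ ∂φ(u)` iff `φ(u) < ∞` and `φ(u) + ⟨f, v - u⟩ ≤ φ(v)` for all `v ∈ H`. -/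
def subdifferential {H : Type*} [NormedAddCommGroup H] [InnerProductSpace ℝ H]
    (φ : H → ℝ≥0∞) (u : H) : Set H :=
  {f | φ u < ∞ ∧ ∀ v : H, (φ u : EReal) + ((inner ℝ f (v - u) : ℝ) : EReal) ≤ (φ v : EReal)}

/-- The null space of a set-valued operator. -/
def nullSpace {H : Type*} [Zero H] (A : H → Set H) : Set H := {u | 0 ∈ A u}

/-- The range of a set-valued operator. -/
def rangeSpace {H : Type*} (A : H → Set H) : Set H := {f | ∃ u, f ∈ A u}

/-- The orthogonal complement of a subset of a real Hilbert space. -/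
def orthComplement {H : Type*} [NormedAddCommGroup H] [InnerProductSpace ℝ H]
    (S : Set H) : Set H := {f | ∀ u ∈ S, inner ℝ u f = 0}

/-- The operator `𝒜 = ∂Ψ` on `L²(Ω)`. -/
noncomputable def opA {N : ℕ} (Ω : Set (EuclideanSpace ℝ (Fin N)))
    (μ : Measure (EuclideanSpace ℝ (Fin N))) (d s η p q : ℝ) :
    Lp ℝ 2 ((volume : Measure (EuclideanSpace ℝ (Fin N))).restrict Ω) →
      Set (Lp ℝ 2 ((volume : Measure (EuclideanSpace ℝ (Fin N))).restrict Ω)) :=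
  subdifferential (Psi Ω μ d s η p q)

/-! ### Gagliardo energies -/

/-! Everything rests on five properties of `Psi` on L²(Ω): it is convex, it is lower semicontinuous,
it does not change when a constant is added, it vanishes exactly on the constants, and on mean-zero
functions of finite energy it satisfies ‖u‖^p ≤ C Ψ(u) with p > 1.

Given these, the theorem is soft. Since Ψ ≥ 0 = Ψ(0), the condition 0 ∈ 𝒜(u) says that u minimises
Ψ, i.e. Ψ(u) = 0, i.e. u is constant. If f ∈ 𝒜(u), testing with u + c leaves Ψ unchanged and gives c
∫ f ≤ 0 for every c, so ∫ f = 0. Conversely, for mean-zero f the direct method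
(`exists_minimiser_of_coercive`) minimises Ψ - ⟨f, ·⟩ over the closed subspace of mean-zero
functions. Subtracting the mean from a competitor changes neither Ψ nor the pairing with f, so the
minimiser is global and f lies in its subdifferential. The third claim follows because a function is
orthogonal to all constants precisely when its mean vanishes.

The analysis lies in coercivity and in lower semicontinuity of the boundary term. Both use the
measure density |B(x,r) ∩ Ω| ≥ c r^N (`IsEpsDeltaDomain.exists_measure_density`). Coercivity is a
Poincaré–Sobolev inequality (`exists_poincare`): u(x) is compared with its averages over balls, the
radius is optimised when p < 2, and the pointwise bound is integrated; the lower bound on p enters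
here. For traces, `exists_trace_estimate` shows that dyadic ball averages converge μ-a.e., at a
geometric rate in L^p(μ) controlled by the interior energy; this uses sp > N - d and the upper
Ahlfors bound. At a fixed scale averages are continuous in L², so along an energy-bounded
L²-convergent sequence the traces converge in measure. On a subsequence they converge a.e., and
Fatou applies to both energies. -/

section Gagliardo

variable {N : ℕ} {ν : Measure (EuclideanSpace ℝ (Fin N))} {r a : ℝ}
  {u v : EuclideanSpace ℝ (Fin N) → ℝ}

/-- The integrand of the Gagliardo energy. -/
noncomputable def gagliardoKernel (r a : ℝ) (u : EuclideanSpace ℝ (Fin N) → ℝ)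
    (x y : EuclideanSpace ℝ (Fin N)) : ℝ≥0∞ :=
  ENNReal.ofReal (|u x - u y| ^ r / ‖x - y‖ ^ a)

theorem measurable_gagliardoKernel (hu : Measurable u) :
    Measurable (fun z : EuclideanSpace ℝ (Fin N) × EuclideanSpace ℝ (Fin N) =>
      gagliardoKernel r a u z.1 z.2) := by
  unfold gagliardoKernel
  fun_prop

theorem measurable_gagliardoKernel_right (hu : Measurable u) (x : EuclideanSpace ℝ (Fin N)) :
    Measurable (gagliardoKernel r a u x) := by
  unfold gagliardoKernel
  fun_prop

theorem measurable_lintegral_gagliardoKernel [SFinite ν] (hu : Measurable u) :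
    Measurable (fun x => ∫⁻ y, gagliardoKernel r a u x y ∂ν) :=
  Measurable.lintegral_prod_right (measurable_gagliardoKernel hu)

theorem gagliardo_eq_lintegral_kernel :
    gagliardo ν r a u = ∫⁻ x, ∫⁻ y, gagliardoKernel r a u x y ∂ν ∂ν := rfl

theorem gagliardo_congr (h : u =ᵐ[ν] v) : gagliardo ν r a u = gagliardo ν r a v := by
  unfold gagliardo
  refine lintegral_congr_ae ?_
  filter_upwards [h] with x hx
  refine lintegral_congr_ae ?_
  filter_upwards [h] with y hy
  rw [hx, hy]

theorem gagliardo_eq_prod [SFinite ν] (hu : Measurable u) :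
    gagliardo ν r a u = ∫⁻ z, gagliardoKernel r a u z.1 z.2 ∂(ν.prod ν) :=
  (lintegral_prod _ (measurable_gagliardoKernel hu).aemeasurable).symm

theorem gagliardo_add_const (c : ℝ) :
    gagliardo ν r a (fun x => u x + c) = gagliardo ν r a u := by
  simp [gagliardo]

theorem gagliardo_neg : gagliardo ν r a (fun x => -u x) = gagliardo ν r a u := by
  unfold gagliardo
  simp_rw [neg_sub_neg, abs_sub_comm]

theorem gagliardo_const (hr : 0 < r) (c : ℝ) : gagliardo ν r a (fun _ => c) = 0 := by
  simp [gagliardo, Real.zero_rpow hr.ne']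

/-- Pointwise convexity of t ↦ |t|^r applied to the difference quotients. Passing to measurable
representatives allows both energies to be treated as integrals over the product space. -/
theorem gagliardo_convex [SFinite ν] (hr : 1 ≤ r) (hu : AEMeasurable u ν) (hv : AEMeasurable v ν)
    {α β : ℝ} (hα : 0 ≤ α) (hβ : 0 ≤ β) (hαβ : α + β = 1) :
    gagliardo ν r a (fun x => α * u x + β * v x) ≤
      ENNReal.ofReal α * gagliardo ν r a u + ENNReal.ofReal β * gagliardo ν r a v := by
  obtain ⟨u', hu', huu⟩ := hu
  obtain ⟨v', hv', hvv⟩ := hv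
  have h1 : gagliardo ν r a (fun x => α * u x + β * v x) =
      gagliardo ν r a (fun x => α * u' x + β * v' x) := by
    refine gagliardo_congr ?_
    filter_upwards [huu, hvv] with x h1 h2
    rw [h1, h2]
  rw [h1, gagliardo_congr huu, gagliardo_congr hvv, gagliardo_eq_prod (by fun_prop),
    gagliardo_eq_prod hu', gagliardo_eq_prod hv',
    ← lintegral_const_mul _ (measurable_gagliardoKernel hu'),
    ← lintegral_const_mul _ (measurable_gagliardoKernel hv'),
    ← lintegral_add_left ((measurable_gagliardoKernel hu').const_mul _)]
  refine lintegral_mono fun z => ?_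
  dsimp only [gagliardoKernel]
  rw [← ENNReal.ofReal_mul hα, ← ENNReal.ofReal_mul hβ,
    ← ENNReal.ofReal_add (by positivity) (by positivity)]
  refine ENNReal.ofReal_le_ofReal ?_
  rw [mul_div_assoc', mul_div_assoc', ← add_div]
  refine div_le_div_of_nonneg_right ?_ (by positivity)
  have h2 := (convexOn_rpow hr).2 (abs_nonneg (u' z.1 - u' z.2)) (abs_nonneg (v' z.1 - v' z.2))
    hα hβ hαβ
  simp only [smul_eq_mul] at h2
  refine le_trans (Real.rpow_le_rpow (abs_nonneg _) ?_ (by linarith)) h2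
  calc |α * u' z.1 + β * v' z.1 - (α * u' z.2 + β * v' z.2)|
      = |α * (u' z.1 - u' z.2) + β * (v' z.1 - v' z.2)| := by ring_nf
    _ ≤ |α * (u' z.1 - u' z.2)| + |β * (v' z.1 - v' z.2)| := abs_add_le _ _
    _ = _ := by rw [abs_mul, abs_mul, abs_of_nonneg hα, abs_of_nonneg hβ]

/-- Fatou's lemma twice, in the outer and then in the inner variable, so that a.e. convergence for ν
alone suffices. -/
theorem gagliardo_le_liminf_of_measurable [SFinite ν] (hr : 0 < r)
    {w : ℕ → EuclideanSpace ℝ (Fin N) → ℝ} (hw : ∀ n, Measurable (w n))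
    (h : ∀ᵐ x ∂ν, Tendsto (fun n => w n x) atTop (𝓝 (u x))) :
    gagliardo ν r a u ≤ liminf (fun n => gagliardo ν r a (w n)) atTop := by
  have h1 : ∫⁻ x, liminf (fun n => ∫⁻ y, gagliardoKernel r a (w n) x y ∂ν) atTop ∂ν ≤
      liminf (fun n => ∫⁻ x, ∫⁻ y, gagliardoKernel r a (w n) x y ∂ν ∂ν) atTop :=
    lintegral_liminf_le fun n => measurable_lintegral_gagliardoKernel (hw n)
  refine le_trans ?_ h1
  rw [gagliardo_eq_lintegral_kernel]
  refine lintegral_mono_ae ?_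
  filter_upwards [h] with x hx
  have h2 : ∫⁻ y, liminf (fun n => gagliardoKernel r a (w n) x y) atTop ∂ν ≤
      liminf (fun n => ∫⁻ y, gagliardoKernel r a (w n) x y ∂ν) atTop :=
    lintegral_liminf_le fun n => measurable_gagliardoKernel_right (hw n) x
  refine le_trans ?_ h2
  refine lintegral_mono_ae ?_
  filter_upwards [h] with y hy
  refine le_of_eq (Tendsto.liminf_eq ?_).symm
  exact ENNReal.tendsto_ofReal
    ((((hx.sub hy).abs).rpow_const (Or.inr hr.le)).div_const (‖x - y‖ ^ a))

/-- Lower semicontinuity of the Gagliardo energy under almost everywhere convergence. -/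
theorem gagliardo_le_liminf [SFinite ν] (hr : 0 < r) {w : ℕ → EuclideanSpace ℝ (Fin N) → ℝ}
    (hw : ∀ n, AEMeasurable (w n) ν)
    (h : ∀ᵐ x ∂ν, Tendsto (fun n => w n x) atTop (𝓝 (u x))) :
    gagliardo ν r a u ≤ liminf (fun n => gagliardo ν r a (w n)) atTop := by
  have e : (fun n => gagliardo ν r a (w n)) = fun n => gagliardo ν r a ((hw n).mk _) :=
    funext fun n => gagliardo_congr (hw n).ae_eq_mk
  rw [e]
  refine gagliardo_le_liminf_of_measurable hr (fun n => (hw n).measurable_mk) ?_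
  filter_upwards [h, ae_all_iff.2 fun n => (hw n).ae_eq_mk] with x hx hx'
  exact hx.congr hx'

/-- On a bounded set, `|u x - u y| ^ r` is dominated by the Gagliardo kernel. -/
theorem ofReal_abs_rpow_le_kernel {R : ℝ} (hr : 0 < r) (ha : 0 ≤ a)
    {x y : EuclideanSpace ℝ (Fin N)} (hxy : ‖x - y‖ ≤ R) :
    ENNReal.ofReal (|u x - u y| ^ r) ≤ ENNReal.ofReal (R ^ a) * gagliardoKernel r a u x y := by
  have hR : 0 ≤ R := (norm_nonneg _).trans hxy
  unfold gagliardoKernel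
  rw [← ENNReal.ofReal_mul (by positivity)]
  refine ENNReal.ofReal_le_ofReal ?_
  rcases eq_or_ne x y with rfl | hne
  · simp [Real.zero_rpow hr.ne']
  have h0 : 0 < ‖x - y‖ := norm_pos_iff.2 (sub_ne_zero.2 hne)
  rw [mul_div_assoc', le_div_iff₀ (by positivity), mul_comm]
  gcongr

/-- Freeze one x for which the inner integral is finite. On a bounded set the kernel dominates |u x
- u y|^r, so u differs from the constant u x by an L^r function. Hence the integrability clauses in
the definition of `Psi` are automatic. -/
theorem memLp_of_gagliardo_lt_top_of_measurable [IsFiniteMeasure ν] {R : ℝ} (hr : 0 < r)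
    (ha : 0 ≤ a) (hum : Measurable u) {S : Set (EuclideanSpace ℝ (Fin N))} (hS : ∀ᵐ x ∂ν, x ∈ S)
    (hR : ∀ x ∈ S, ∀ y ∈ S, ‖x - y‖ ≤ R) (hfin : gagliardo ν r a u < ∞) :
    MemLp u (ENNReal.ofReal r) ν := by
  rcases eq_or_ne ν 0 with rfl | hν
  · simp
  have : (ae ν).NeBot := ae_neBot.2 hν
  have h1 : ∀ᵐ x ∂ν, ∫⁻ y, gagliardoKernel r a u x y ∂ν < ∞ :=
    ae_lt_top (measurable_lintegral_gagliardoKernel hum) hfin.ne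
  obtain ⟨x, hx, hxS⟩ := (h1.and hS).exists
  have h2 : MemLp (fun y => u x - u y) (ENNReal.ofReal r) ν := by
    refine ⟨(by fun_prop : Measurable fun y => u x - u y).aestronglyMeasurable, ?_⟩
    rw [eLpNorm_lt_top_iff_lintegral_rpow_enorm_lt_top (by simpa using hr) ENNReal.ofReal_ne_top,
      ENNReal.toReal_ofReal hr.le]
    calc ∫⁻ y, ‖u x - u y‖ₑ ^ r ∂ν
        ≤ ∫⁻ y, ENNReal.ofReal (R ^ a) * gagliardoKernel r a u x y ∂ν := by
          refine lintegral_mono_ae ?_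
          filter_upwards [hS] with y hy
          rw [Real.enorm_eq_ofReal_abs, ENNReal.ofReal_rpow_of_nonneg (abs_nonneg _) hr.le]
          exact ofReal_abs_rpow_le_kernel hr ha (hR x hxS y hy)
      _ = ENNReal.ofReal (R ^ a) * ∫⁻ y, gagliardoKernel r a u x y ∂ν :=
          lintegral_const_mul _ (measurable_gagliardoKernel_right hum x)
      _ < ∞ := ENNReal.mul_lt_top ENNReal.ofReal_lt_top hx
  have h3 := (memLp_const (u x) (p := ENNReal.ofReal r) (μ := ν)).sub h2
  have h4 : ((fun _ => u x) - fun y => u x - u y) = u := by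
    funext y
    exact sub_sub_cancel _ _
  rwa [h4] at h3

theorem memLp_of_gagliardo_lt_top [IsFiniteMeasure ν] {R : ℝ} (hr : 0 < r) (ha : 0 ≤ a)
    (hu : AEMeasurable u ν) {S : Set (EuclideanSpace ℝ (Fin N))} (hS : ∀ᵐ x ∂ν, x ∈ S)
    (hR : ∀ x ∈ S, ∀ y ∈ S, ‖x - y‖ ≤ R) (hfin : gagliardo ν r a u < ∞) :
    MemLp u (ENNReal.ofReal r) ν := by
  rw [gagliardo_congr hu.ae_eq_mk] at hfin
  exact (memLp_congr_ae hu.ae_eq_mk).2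
    (memLp_of_gagliardo_lt_top_of_measurable hr ha hu.measurable_mk hS hR hfin)

/-- For almost every x the inner integral vanishes; a single such x suffices, because the kernel is
positive wherever u y ≠ u x. -/
theorem ae_const_of_gagliardo_eq_zero [SFinite ν] (hum : Measurable u)
    (h0 : gagliardo ν r a u = 0) : ∃ c, ∀ᵐ x ∂ν, u x = c := by
  rcases eq_or_ne ν 0 with rfl | hν
  · exact ⟨0, by simp⟩
  have : (ae ν).NeBot := ae_neBot.2 hν
  have h1 := (lintegral_eq_zero_iff (measurable_lintegral_gagliardoKernel hum)).1 h0
  obtain ⟨x, hx⟩ := h1.exists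
  have h2 := (lintegral_eq_zero_iff (measurable_gagliardoKernel_right hum x)).1 hx
  refine ⟨u x, ?_⟩
  filter_upwards [h2] with y hy
  by_contra hne
  have h3 : x ≠ y := by rintro rfl; exact hne rfl
  have h4 : 0 < ‖x - y‖ := norm_pos_iff.2 (sub_ne_zero.2 h3)
  have h5 : 0 < |u x - u y| := abs_pos.2 (sub_ne_zero.2 (Ne.symm hne))
  simp only [gagliardoKernel, Pi.zero_apply, ENNReal.ofReal_eq_zero] at hy
  exact absurd hy (not_le.2 (by positivity))

end Gagliardo

/-- Jensen's inequality for the average of a function over a set. -/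
theorem ofReal_abs_setAverage_sub_rpow_le {X : Type*} [MeasurableSpace X] {ν : Measure X}
    {A : Set X} (hA0 : ν A ≠ 0) (hA : ν A ≠ ∞) {u : X → ℝ} (hu : IntegrableOn u A ν) {r : ℝ}
    (hr : 1 ≤ r) (c : ℝ) :
    ENNReal.ofReal (|(⨍ y in A, u y ∂ν) - c| ^ r) ≤
      (ν A)⁻¹ * ∫⁻ y in A, ENNReal.ofReal (|u y - c| ^ r) ∂ν := by
  have hr0 : 0 < r := by linarith
  have hfin : IsFiniteMeasure (ν.restrict A) := ⟨by simpa using hA.lt_top⟩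
  have : NeZero (ν.restrict A) := ⟨by simpa using hA0⟩
  -- Normalising to a probability measure turns Jensen's inequality into monotonicity of L^r norms
  -- in the exponent.
  set P := ((ν.restrict A) univ)⁻¹ • ν.restrict A with hP
  have hPp : IsProbabilityMeasure P := isProbabilityMeasureSMul
  have huP : Integrable u P := hu.smul_measure (by simpa using hA0)
  have e1 : (⨍ y in A, u y ∂ν) - c = ∫ y, (u y - c) ∂P := by
    rw [integral_sub huP (integrable_const c), integral_const, probReal_univ, one_smul]
    rfl
  have e2 : (ν A)⁻¹ * ∫⁻ y in A, ENNReal.ofReal (|u y - c| ^ r) ∂ν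
      = ∫⁻ y, ‖u y - c‖ₑ ^ r ∂P := by
    rw [hP, lintegral_smul_measure]
    simp only [Measure.restrict_apply_univ, smul_eq_mul]
    congr 2 with y
    rw [Real.enorm_eq_ofReal_abs, ENNReal.ofReal_rpow_of_nonneg (abs_nonneg _) hr0.le]
  rw [e1, e2, ← ENNReal.ofReal_rpow_of_nonneg (abs_nonneg _) hr0.le, ← Real.enorm_eq_ofReal_abs]
  have h1 := enorm_integral_le_lintegral_enorm (μ := P) (fun y => u y - c)
  have h2 : eLpNorm (fun y => u y - c) 1 P ≤ eLpNorm (fun y => u y - c) (ENNReal.ofReal r) P :=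
    eLpNorm_le_eLpNorm_of_exponent_le (by simpa using hr)
      (huP.sub (integrable_const c)).aestronglyMeasurable
  rw [eLpNorm_one_eq_lintegral_enorm, eLpNorm_eq_lintegral_rpow_enorm_toReal (by simpa using hr0)
    ENNReal.ofReal_ne_top, ENNReal.toReal_ofReal hr0.le] at h2
  calc ‖∫ y, (u y - c) ∂P‖ₑ ^ r
      ≤ ((∫⁻ y, ‖u y - c‖ₑ ^ r ∂P) ^ (1 / r)) ^ r :=
        ENNReal.rpow_le_rpow (h1.trans h2) hr0.le
    _ = _ := by rw [← ENNReal.rpow_mul, one_div_mul_cancel hr0.ne', ENNReal.rpow_one]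

/-! ### Measure density of `(ε, δ)`-domains -/

section Density

variable {N : ℕ} {Ω : Set (EuclideanSpace ℝ (Fin N))} {ε δ : ℝ}

theorem volume_euclidean_ball_eq [Nonempty (Fin N)] (x : EuclideanSpace ℝ (Fin N)) {r : ℝ} (hr : 0 ≤ r) :
    volume (Metric.ball x r) = ENNReal.ofReal
      (r ^ N * (volume (Metric.ball (0 : EuclideanSpace ℝ (Fin N)) 1)).toReal) := by
  rw [Measure.addHaar_ball _ _ hr, finrank_euclideanSpace_fin, ENNReal.ofReal_mul (by positivity),
    ENNReal.ofReal_toReal measure_ball_lt_top.ne]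

theorem IsEpsDeltaDomain.exists_ball_subset (hΩ : IsEpsDeltaDomain ε δ Ω)
    {p q : EuclideanSpace ℝ (Fin N)} (hp : p ∈ Ω) (hq : q ∈ Ω) {x : EuclideanSpace ℝ (Fin N)}
    (hx : x ∈ Ω) {r : ℝ} (hr : 0 < r) (hrδ : r < δ) (hrd : r ≤ dist p q) :
    ∃ z, Metric.ball z (min ε 1 * r / 8) ⊆ Metric.ball x r ∩ Ω := by
  obtain ⟨hε, hδ, ho, hc, h⟩ := hΩ
  -- One of p and q works: otherwise both lie within r/2 of x and dist p q < r.
  have hfar : ∃ w ∈ Ω, r / 2 ≤ dist x w := by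
    by_contra! hcon
    have := dist_triangle_left p q x
    have h1 := hcon p hp
    have h2 := hcon q hq
    linarith
  obtain ⟨w, hw, hxw⟩ := hfar
  have hcont : ContinuousOn (fun y => dist x y) Ω := by fun_prop
  obtain ⟨y, hy, hxy⟩ := hc.isPreconnected.intermediate_value hx hw hcont
    (show r / 2 ∈ Icc (dist x x) (dist x w) from ⟨by rw [dist_self]; positivity, hxw⟩)
  simp only [dist_eq_norm] at hxy
  obtain ⟨γ, hγ, h0, h1, hγΩ, -, hdist⟩ := h x hx y hy (by linarith)
  have hcont' : ContinuousOn (fun t => ‖x - γ t‖) (Icc 0 1) := by fun_prop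
  -- As |x - y| = r/2, the point of the curve at distance r/4 from x is at least r/4 away from y.
  -- Its distance to the complement is then at least ε (r/4)² / (r/2) = ε r / 8.
  have hmem : r / 4 ∈ Icc (‖x - γ 0‖) (‖x - γ 1‖) := by
    rw [h0, h1, sub_self, norm_zero, hxy]
    constructor <;> linarith
  obtain ⟨t, ht, htr⟩ := intermediate_value_Icc zero_le_one hcont' hmem
  simp only at htr
  have hyt : r / 4 ≤ ‖y - γ t‖ := by
    have h3 : ‖x - y‖ ≤ ‖x - γ t‖ + ‖y - γ t‖ := by
      rw [← norm_neg (y - γ t)]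
      refine le_trans (le_of_eq ?_) (norm_add_le _ _)
      congr 1
      abel
    linarith
  have hinf : min ε 1 * r / 8 ≤ Metric.infDist (γ t) Ωᶜ := by
    refine le_trans ?_ (hdist t ht)
    rw [htr, hxy, le_div_iff₀ (by positivity)]
    have h4 : min ε 1 ≤ ε := min_le_left _ _
    have h5 : ε * (r / 4) * (r / 4) ≤ ε * (r / 4) * ‖y - γ t‖ := by gcongr
    have h6 : min ε 1 * (r * r) ≤ ε * (r * r) := by gcongr
    nlinarith
  refine ⟨γ t, fun z hz => ⟨?_, ?_⟩⟩
  · rw [Metric.mem_ball] at hz ⊢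
    have h7 : dist z x ≤ dist z (γ t) + dist (γ t) x := dist_triangle _ _ _
    rw [dist_comm (γ t) x, dist_eq_norm x, htr] at h7
    have h8 : min ε 1 * r ≤ 1 * r := by
      gcongr
      exact min_le_right _ _
    linarith
  · exact Metric.ball_infDist_compl_subset (Metric.ball_subset_ball hinf hz)

/-- An `(ε, δ)`-domain satisfies the measure density condition at all points of its
closure. -/
theorem IsEpsDeltaDomain.exists_measure_density (hN : 0 < N) (hΩ : IsEpsDeltaDomain ε δ Ω) :
    ∃ c R : ℝ, 0 < c ∧ 0 < R ∧ R ≤ 1 / 2 ∧ ∀ x ∈ closure Ω, ∀ r : ℝ, 0 < r → r ≤ R →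
      ENNReal.ofReal (c * r ^ (N : ℝ)) ≤ volume (Metric.ball x r ∩ Ω) := by
  have : Nonempty (Fin N) := ⟨⟨0, hN⟩⟩
  obtain ⟨p, hp⟩ := hΩ.2.2.2.1.nonempty
  obtain ⟨q, hq, hpq⟩ : ∃ q ∈ Ω, q ≠ p := by
    have h1 := (hΩ.2.2.1.mem_nhds hp)
    have h2 : (𝓝[≠] p).NeBot := inferInstance
    obtain ⟨q, hq1, hq2⟩ := (h2.nonempty_of_mem (inter_mem (mem_nhdsWithin_of_mem_nhds h1)
      self_mem_nhdsWithin))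
    exact ⟨q, hq1, hq2⟩
  have hd : 0 < dist p q := dist_pos.2 hpq.symm
  have hε : 0 < ε := hΩ.1
  have hδ : 0 < δ := hΩ.2.1
  have hm : 0 < min ε 1 := lt_min hε one_pos
  set V := (volume (Metric.ball (0 : EuclideanSpace ℝ (Fin N)) 1)).toReal with hV
  have hV0 : 0 < V := ENNReal.toReal_pos
    (Metric.measure_ball_pos _ _ one_pos).ne' measure_ball_lt_top.ne
  -- A point of the closure is first moved to a point of Ω at the cost of half the radius, whence 16
  -- instead of 8. The cap 1/2 on R keeps doubled radii in the range (0, 1] of the Ahlfors bound.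
  refine ⟨(min ε 1 / 16) ^ N * V, min (min (δ / 2) (dist p q)) (1 / 2), by positivity, by positivity,
    min_le_right _ _, fun x hx r hr hrR => ?_⟩
  have hr1 : r ≤ δ / 2 := hrR.trans ((min_le_left _ _).trans (min_le_left _ _))
  have hr2 : r ≤ dist p q := hrR.trans ((min_le_left _ _).trans (min_le_right _ _))
  obtain ⟨x', hx', hxx'⟩ := Metric.mem_closure_iff.1 hx (r / 2) (by positivity)
  obtain ⟨z, hz⟩ := hΩ.exists_ball_subset hp hq hx' (r := r / 2) (by positivity) (by linarith)
    (by linarith)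
  calc ENNReal.ofReal ((min ε 1 / 16) ^ N * V * r ^ (N : ℝ))
      = volume (Metric.ball z (min ε 1 * (r / 2) / 8)) := by
        rw [volume_euclidean_ball_eq _ (by positivity), Real.rpow_natCast]
        congr 1
        rw [show min ε 1 * (r / 2) / 8 = (min ε 1 / 16) * r by ring, mul_pow]
        ring
    _ ≤ volume (Metric.ball x r ∩ Ω) := by
        refine measure_mono (hz.trans (inter_subset_inter_left _ ?_))
        refine Metric.ball_subset_ball' ?_
        rw [dist_comm]
        linarith

end Density

/-! ### The fractional Poincaré–Sobolev inequality -/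

section Poincare

variable {N : ℕ} {Ω : Set (EuclideanSpace ℝ (Fin N))} {p a : ℝ} {u : EuclideanSpace ℝ (Fin N) → ℝ}

theorem measure_ne_zero_of_ofReal_le {X : Type*} [MeasurableSpace X] {ν : Measure X} {B : Set X}
    {b : ℝ} (hb : 0 < b) (h : ENNReal.ofReal b ≤ ν B) : ν B ≠ 0 := fun h0 => by
  rw [h0, nonpos_iff_eq_zero, ENNReal.ofReal_eq_zero] at h
  linarith

theorem inv_measure_le {X : Type*} [MeasurableSpace X] {ν : Measure X} {B : Set X} {b : ℝ}
    (hb : 0 < b) (h : ENNReal.ofReal b ≤ ν B) : (ν B)⁻¹ ≤ ENNReal.ofReal b⁻¹ := by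
  rw [ENNReal.ofReal_inv_of_pos hb]
  exact ENNReal.inv_le_inv.2 h

/-- Distance from the value of a function to its average, in terms of the Gagliardo kernel. -/
theorem abs_setAverage_sub_value_rpow_le (hp : 1 ≤ p) (ha : 0 ≤ a) (hΩ : volume Ω ≠ ∞)
    (hu : Measurable u) (hint : IntegrableOn u Ω) {B : Set (EuclideanSpace ℝ (Fin N))}
    (hBΩ : B ⊆ Ω) (hBm : MeasurableSet B) {b ρ : ℝ} (hb : 0 < b)
    (hbB : ENNReal.ofReal b ≤ volume B) {x : EuclideanSpace ℝ (Fin N)}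
    (hρ : ∀ y ∈ B, ‖x - y‖ ≤ ρ) (hρ0 : 0 ≤ ρ)
    (hfin : ∫⁻ y in Ω, gagliardoKernel p a u x y < ∞) :
    |(⨍ y in B, u y) - u x| ^ p ≤
      b⁻¹ * ρ ^ a * (∫⁻ y in Ω, gagliardoKernel p a u x y).toReal := by
  have hB : volume B ≠ ∞ := ne_top_of_le_ne_top hΩ (measure_mono hBΩ)
  have h1 := ofReal_abs_setAverage_sub_rpow_le (measure_ne_zero_of_ofReal_le hb hbB) hB
    (hint.mono_set hBΩ) hp (u x)
  have h2 : ∫⁻ y in B, ENNReal.ofReal (|u y - u x| ^ p) ≤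
      ENNReal.ofReal (ρ ^ a) * ∫⁻ y in Ω, gagliardoKernel p a u x y := by
    rw [← lintegral_const_mul _ (measurable_gagliardoKernel_right hu x)]
    refine (setLIntegral_mono' hBm fun y hy => ?_).trans (lintegral_mono_set hBΩ)
    rw [abs_sub_comm]
    exact ofReal_abs_rpow_le_kernel (by linarith) ha (hρ y hy)
  have h3 := h1.trans (mul_le_mul' (inv_measure_le hb hbB) h2)
  rw [← ENNReal.ofReal_toReal hfin.ne, ← ENNReal.ofReal_mul (by positivity),
    ← ENNReal.ofReal_mul (by positivity), ← mul_assoc] at h3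
  exact (ENNReal.ofReal_le_ofReal_iff (by positivity)).1 h3

/-- Jensen's inequality with exponent 2; A stands for the L² norm. It serves both the interpolation
in the Poincaré inequality and the L²-continuity of averages at a fixed scale. -/
theorem abs_setAverage_sq_le (hΩ : volume Ω ≠ ∞) (hint : IntegrableOn u Ω)
    {B : Set (EuclideanSpace ℝ (Fin N))} (hBΩ : B ⊆ Ω) {b A : ℝ} (hb : 0 < b)
    (hbB : ENNReal.ofReal b ≤ volume B)
    (hA : ∫⁻ y in Ω, ENNReal.ofReal (u y ^ 2) = ENNReal.ofReal (A ^ 2)) :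
    |⨍ y in B, u y| ^ 2 ≤ b⁻¹ * A ^ 2 := by
  have hB : volume B ≠ ∞ := ne_top_of_le_ne_top hΩ (measure_mono hBΩ)
  have h1 := ofReal_abs_setAverage_sub_rpow_le (measure_ne_zero_of_ofReal_le hb hbB) hB
    (hint.mono_set hBΩ) one_le_two 0
  simp only [sub_zero, Real.rpow_two, sq_abs] at h1
  have h3 := h1.trans (mul_le_mul' (inv_measure_le hb hbB) (lintegral_mono_set hBΩ))
  rw [hA, ← ENNReal.ofReal_mul (by positivity)] at h3
  rw [sq_abs]
  exact (ENNReal.ofReal_le_ofReal_iff (by positivity)).1 h3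

/-- The interpolation step in the fractional Sobolev inequality: optimising the radius in a bound
by a fractional maximal function. -/
theorem sq_le_of_forall_radius {n s c R C U G A : ℝ} (hn : 0 < n) (hp1 : 0 < p) (hp2 : p < 2)
    (hs : n / p ≤ n / 2 + s) (hc : 0 < c) (hR : 0 < R) (hR1 : R ≤ 1) (hC : 0 ≤ C) (hU : 0 ≤ U)
    (hG : 0 ≤ G) (hA : 0 < A)
    (h1 : ∀ r, 0 < r → r ≤ R → U ≤ (c⁻¹ * r ^ (s * p) * G) ^ (1 / p) +
      (c⁻¹ * r ^ (-n) * A ^ 2) ^ (1 / 2 : ℝ))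
    (h2 : U ^ p ≤ C * G) :
    U ^ 2 ≤ ((c⁻¹ ^ (1 / p) + c⁻¹ ^ (1 / 2 : ℝ)) ^ 2 + C ^ (2 / p) * (R ^ (-n)) ^ (2 / p - 1)) *
      A ^ (2 - p) * G := by
  rcases hG.eq_or_lt with rfl | hG
  · have h3 : U ^ p = 0 := le_antisymm (by simpa using h2) (by positivity)
    rw [Real.rpow_eq_zero hU hp1.ne'] at h3
    simp [h3]
  -- For this radius the two terms of `h1` are multiples of A r^(s - n/p) and A r^(-n/2). They
  -- balance in the critical case s - n/p = -n/2; otherwise r ≤ 1 makes the first power at most the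
  -- second.
  set r := (A ^ p / G) ^ (1 / n) with hr
  have hr0 : 0 < r := by positivity
  have hrn : r ^ n = A ^ p / G := by
    rw [hr, ← Real.rpow_mul (by positivity), one_div_mul_cancel hn.ne', Real.rpow_one]
  rcases le_or_gt r R with hrR | hrR
  · have hGe : G = A ^ p * r ^ (-n) := by
      rw [Real.rpow_neg hr0.le, hrn]
      field_simp
    have hX : (c⁻¹ * r ^ (s * p) * G) ^ (1 / p) ≤ c⁻¹ ^ (1 / p) * (A * r ^ (-n / 2)) := by
      have e : c⁻¹ * r ^ (s * p) * G = c⁻¹ * (A * r ^ (s - n / p)) ^ p := by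
        rw [hGe, Real.mul_rpow hA.le (by positivity), ← Real.rpow_mul hr0.le]
        have : r ^ ((s - n / p) * p) = r ^ (s * p) * r ^ (-n) := by
          rw [← Real.rpow_add hr0]
          congr 1
          field_simp
          ring
        rw [this]
        ring
      rw [e, Real.mul_rpow (by positivity) (by positivity), ← Real.rpow_mul (by positivity),
        mul_one_div_cancel hp1.ne', Real.rpow_one]
      refine mul_le_mul_of_nonneg_left (mul_le_mul_of_nonneg_left
        (Real.rpow_le_rpow_of_exponent_ge hr0 (hrR.trans hR1) ?_) hA.le) (by positivity)
      linarith
    have hY : (c⁻¹ * r ^ (-n) * A ^ 2) ^ (1 / 2 : ℝ) = c⁻¹ ^ (1 / 2 : ℝ) * (A * r ^ (-n / 2)) := by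
      have e : c⁻¹ * r ^ (-n) * A ^ 2 = c⁻¹ * (A * r ^ (-n / 2)) ^ (2 : ℝ) := by
        rw [Real.mul_rpow hA.le (by positivity), ← Real.rpow_mul hr0.le, Real.rpow_two,
          div_mul_cancel₀ _ two_ne_zero]
        ring
      rw [e, Real.mul_rpow (by positivity) (by positivity), ← Real.rpow_mul (by positivity)]
      norm_num
    have hUle : U ≤ (c⁻¹ ^ (1 / p) + c⁻¹ ^ (1 / 2 : ℝ)) * (A * r ^ (-n / 2)) := by
      have := h1 r hr0 hrR
      rw [hY] at this
      linarith
    have hGA : (A * r ^ (-n / 2)) ^ 2 = A ^ (2 - p) * G := by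
      rw [hGe, ← mul_assoc, ← Real.rpow_add hA, sub_add_cancel, Real.rpow_two, mul_pow,
        ← Real.rpow_natCast (r ^ (-n / 2)) 2, ← Real.rpow_mul hr0.le]
      congr 2
      push_cast
      ring
    calc U ^ 2 ≤ ((c⁻¹ ^ (1 / p) + c⁻¹ ^ (1 / 2 : ℝ)) * (A * r ^ (-n / 2))) ^ 2 := by gcongr
      _ = (c⁻¹ ^ (1 / p) + c⁻¹ ^ (1 / 2 : ℝ)) ^ 2 * A ^ (2 - p) * G := by
        rw [mul_pow, hGA]
        ring
      _ ≤ _ := by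
        gcongr
        exact le_add_of_nonneg_right (by positivity)
  -- The balancing radius is not admissible, but then G is small compared with A^p, and the surplus
  -- power G^(2/p - 1) in `h2` can be traded for A^(2 - p).
  · have hGle : G ≤ A ^ p * R ^ (-n) := by
      have h3 : R ^ n ≤ A ^ p / G := by
        rw [← hrn]
        gcongr
      rw [le_div_iff₀ hG] at h3
      rw [Real.rpow_neg hR.le, ← div_eq_mul_inv, le_div_iff₀ (by positivity)]
      linarith
    have hexp : 0 ≤ 2 / p - 1 := by
      rw [sub_nonneg, le_div_iff₀ hp1]
      linarith
    calc U ^ 2 = (U ^ p) ^ (2 / p) := by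
          rw [← Real.rpow_mul hU, mul_div_cancel₀ _ hp1.ne', Real.rpow_two]
      _ ≤ (C * G) ^ (2 / p) := by gcongr
      _ = C ^ (2 / p) * G ^ (2 / p - 1) * G := by
          rw [Real.mul_rpow hC hG.le, mul_assoc, Real.rpow_sub_one hG.ne',
            div_mul_cancel₀ _ hG.ne']
      _ ≤ C ^ (2 / p) * (A ^ p * R ^ (-n)) ^ (2 / p - 1) * G := by gcongr
      _ = C ^ (2 / p) * (R ^ (-n)) ^ (2 / p - 1) * A ^ (2 - p) * G := by
          have e : p * (2 / p - 1) = 2 - p := by field_simp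
          rw [Real.mul_rpow (by positivity) (by positivity), ← Real.rpow_mul hA.le, e]
          ring
      _ ≤ _ := by
          gcongr
          exact le_add_of_nonneg_left (by positivity)

/-- Split at the level l: above it, U² = U^(2-p) U^p with a nonpositive exponent 2 - p. This
replaces the interpolation when p ≥ 2. -/
theorem sq_le_add_of_rpow_le {C U G l : ℝ} (hp : 2 ≤ p) (hU : 0 ≤ U) (hl : 0 < l)
    (h : U ^ p ≤ C * G) : U ^ 2 ≤ l ^ 2 + l ^ (2 - p) * (C * G) := by
  have hCG : 0 ≤ C * G := le_trans (by positivity) h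
  rcases le_total U l with h1 | h1
  · have : U ^ 2 ≤ l ^ 2 := by gcongr
    have : 0 ≤ l ^ (2 - p) * (C * G) := by positivity
    linarith
  · have hU0 : 0 < U := hl.trans_le h1
    have h2 : U ^ 2 = U ^ (2 - p) * U ^ p := by
      rw [← Real.rpow_add hU0, sub_add_cancel, Real.rpow_two]
    have h3 : U ^ (2 - p) ≤ l ^ (2 - p) := Real.rpow_le_rpow_of_nonpos hl h1 (by linarith)
    have h4 : U ^ (2 - p) * U ^ p ≤ l ^ (2 - p) * (C * G) := by gcongr
    nlinarith [sq_nonneg l]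

/-- The Poincaré–Sobolev inequality for functions of mean zero: the `L²` norm is controlled by the
Gagliardo energy. -/
theorem exists_poincare {s c R D : ℝ} (hN : 0 < N) (hΩo : IsOpen Ω) (hΩne : Ω.Nonempty)
    (hD : ∀ x ∈ Ω, ∀ y ∈ Ω, ‖x - y‖ ≤ D) (hΩfin : volume Ω ≠ ∞) (hs : 0 < s) (hp1 : 1 < p)
    (hps : N / p ≤ N / 2 + s) (hc : 0 < c) (hR : 0 < R) (hR1 : R ≤ 1)
    (hdens : ∀ x ∈ Ω, ∀ r : ℝ, 0 < r → r ≤ R →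
      ENNReal.ofReal (c * r ^ (N : ℝ)) ≤ volume (Metric.ball x r ∩ Ω)) :
    ∃ C : ℝ, 0 ≤ C ∧ ∀ (u : EuclideanSpace ℝ (Fin N) → ℝ) (A : ℝ), Measurable u →
      IntegrableOn u Ω → ∫ x in Ω, u x = 0 → 0 ≤ A →
      ∫⁻ y in Ω, ENNReal.ofReal (u y ^ 2) = ENNReal.ofReal (A ^ 2) →
      interiorEnergy Ω s p u < ∞ → A ^ p ≤ C * (interiorEnergy Ω s p u).toReal := by
  have hN' : (0 : ℝ) < N := Nat.cast_pos.2 hN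
  have hp0 : 0 < p := by linarith
  have ha : 0 ≤ N + s * p := by positivity
  obtain ⟨x0, hx0⟩ := hΩne
  have hD0 : 0 ≤ D := (norm_nonneg _).trans (hD x0 hx0 x0 hx0)
  set V := (volume Ω).toReal with hV
  have hV0 : 0 < V := ENNReal.toReal_pos (hΩo.measure_pos _ ⟨x0, hx0⟩).ne' hΩfin
  have hVe : ENNReal.ofReal V = volume Ω := ENNReal.ofReal_toReal hΩfin
  set C₃ := V⁻¹ * D ^ (N + s * p) with hC₃
  have hC₃0 : 0 ≤ C₃ := by positivity
  set K₁ := (c⁻¹ ^ (1 / p) + c⁻¹ ^ (1 / 2 : ℝ)) ^ 2 +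
    C₃ ^ (2 / p) * (R ^ (-(N : ℝ))) ^ (2 / p - 1) with hK₁
  set K₂ := ((2 * V) ^ (-(1 / 2) : ℝ)) ^ (2 - p) * C₃ with hK₂
  have hK₁0 : 0 ≤ K₁ := by positivity
  have hK₂0 : 0 ≤ K₂ := by positivity
  refine ⟨2 * (K₁ + K₂), by positivity, fun u A hu hint hmean hA0 hA hE => ?_⟩
  rcases hA0.eq_or_lt with rfl | hA0
  · rw [Real.zero_rpow hp0.ne']
    positivity
  set E := interiorEnergy Ω s p u with hEdef
  set Γ := fun x => ∫⁻ y in Ω, gagliardoKernel p (N + s * p) u x y with hΓ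
  have hΓm : Measurable Γ := measurable_lintegral_gagliardoKernel hu
  have hΓfin : ∀ᵐ x ∂(volume.restrict Ω), Γ x < ∞ := ae_lt_top hΓm hE.ne
  have hpt : ∀ᵐ x ∂(volume.restrict Ω), u x ^ 2 ≤
      A ^ 2 / (2 * V) + (K₁ + K₂) * A ^ (2 - p) * (Γ x).toReal := by
    filter_upwards [hΓfin, ae_restrict_mem hΩo.measurableSet] with x hx hxΩ
    -- The average over all of Ω is zero, so comparing u x with it bounds u x itself.
    have h2 : |u x| ^ p ≤ C₃ * (Γ x).toReal := by
      have h := abs_setAverage_sub_value_rpow_le hp1.le ha hΩfin hu hint Subset.rfl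
        hΩo.measurableSet hV0 hVe.le (hD x hxΩ) hD0 hx
      rwa [setAverage_eq, hmean, smul_zero, zero_sub, abs_neg] at h
    rw [← sq_abs (u x)]
    rcases lt_or_ge p 2 with hp2 | hp2
    · have h1 : ∀ r, 0 < r → r ≤ R → |u x| ≤ (c⁻¹ * r ^ (s * p) * (Γ x).toReal) ^ (1 / p) +
          (c⁻¹ * r ^ (-(N : ℝ)) * A ^ 2) ^ (1 / 2 : ℝ) := by
        intro r hr hrR
        have hb := hdens x hxΩ r hr hrR
        have hb0 : 0 < c * r ^ (N : ℝ) := by positivity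
        have i1 := abs_setAverage_sub_value_rpow_le hp1.le ha hΩfin hu hint inter_subset_right
          (measurableSet_ball.inter hΩo.measurableSet) hb0 hb (ρ := r) (x := x)
          (fun y hy => by
            have := hy.1
            rw [Metric.mem_ball, dist_comm, dist_eq_norm] at this
            exact this.le) hr.le hx
        have i2 := abs_setAverage_sq_le hΩfin hint inter_subset_right hb0 hb hA
        set m := ⨍ y in Metric.ball x r ∩ Ω, u y
        have e1 : (c * r ^ (N : ℝ))⁻¹ * r ^ (N + s * p) = c⁻¹ * r ^ (s * p) := by
          rw [Real.rpow_add hr]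
          field_simp
        have e2 : (c * r ^ (N : ℝ))⁻¹ = c⁻¹ * r ^ (-(N : ℝ)) := by
          rw [Real.rpow_neg hr.le, mul_inv]
        rw [e1] at i1
        rw [e2] at i2
        have j1 : |m - u x| ≤ (c⁻¹ * r ^ (s * p) * (Γ x).toReal) ^ (1 / p) := by
          rw [← Real.rpow_rpow_inv (abs_nonneg (m - u x)) hp0.ne', ← one_div]
          gcongr
        have j2 : |m| ≤ (c⁻¹ * r ^ (-(N : ℝ)) * A ^ 2) ^ (1 / 2 : ℝ) := by
          rw [← Real.sqrt_eq_rpow]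
          exact Real.le_sqrt_of_sq_le i2
        have j3 : |u x| ≤ |m - u x| + |m| := by
          rw [abs_sub_comm]
          simpa using abs_add_le (u x - m) m
        linarith
      have h3 := sq_le_of_forall_radius hN' hp0 hp2 hps hc hR hR1 hC₃0 (abs_nonneg (u x))
        ENNReal.toReal_nonneg hA0 h1 h2
      rw [← hK₁] at h3
      refine h3.trans (le_add_of_nonneg_of_le (by positivity) ?_)
      gcongr
      exact le_add_of_nonneg_right hK₂0
    -- The level l is chosen so that l² |Ω| = A²/2; after integration this term is absorbed by the
    -- left-hand side A².
    · have hl : 0 < A * (2 * V) ^ (-(1 / 2) : ℝ) := by positivity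
      refine (sq_le_add_of_rpow_le hp2 (abs_nonneg (u x)) hl h2).trans ?_
      have e1 : (A * (2 * V) ^ (-(1 / 2) : ℝ)) ^ 2 = A ^ 2 / (2 * V) := by
        rw [mul_pow, ← Real.rpow_natCast ((2 * V) ^ (-(1 / 2) : ℝ)) 2,
          ← Real.rpow_mul (by positivity)]
        norm_num [Real.rpow_neg_one]
        ring
      have e2 : (A * (2 * V) ^ (-(1 / 2) : ℝ)) ^ (2 - p) * (C₃ * (Γ x).toReal) =
          K₂ * A ^ (2 - p) * (Γ x).toReal := by
        rw [Real.mul_rpow hA0.le (by positivity), hK₂]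
        ring
      rw [e1, e2]
      gcongr
      exact le_add_of_nonneg_left hK₁0
  have hint2 : ENNReal.ofReal (A ^ 2) ≤ ENNReal.ofReal (A ^ 2 / (2 * V)) * ENNReal.ofReal V +
      ENNReal.ofReal ((K₁ + K₂) * A ^ (2 - p)) * E := by
    have e : E = ∫⁻ x in Ω, Γ x := rfl
    rw [e, ← hA, hVe, ← lintegral_const_mul _ hΓm, ← setLIntegral_const,
      ← lintegral_add_left measurable_const]
    refine lintegral_mono_ae ?_
    filter_upwards [hpt, hΓfin] with x hx hxfin
    rw [← ENNReal.ofReal_toReal hxfin.ne, ← ENNReal.ofReal_mul (by positivity), ← ENNReal.ofReal_add (by positivity) (by positivity)]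
    exact ENNReal.ofReal_le_ofReal hx
  rw [← ENNReal.ofReal_toReal hE.ne, ← ENNReal.ofReal_mul (by positivity),
    ← ENNReal.ofReal_mul (by positivity), ← ENNReal.ofReal_add (by positivity) (by positivity),
    ENNReal.ofReal_le_ofReal_iff (by positivity)] at hint2
  have e3 : A ^ 2 / (2 * V) * V = A ^ 2 / 2 := by field_simp
  rw [e3] at hint2
  have e4 : A ^ 2 = A ^ (2 - p) * A ^ p := by
    rw [← Real.rpow_add hA0, sub_add_cancel, Real.rpow_two]
  have hpos : 0 < A ^ (2 - p) := by positivity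
  refine le_of_mul_le_mul_left ?_ hpos
  rw [← e4]
  linarith

end Poincare

/-! ### Traces -/

section Trace

variable {N : ℕ} {Ω F : Set (EuclideanSpace ℝ (Fin N))} {μ : Measure (EuclideanSpace ℝ (Fin N))}
  {p s d : ℝ} {u v : EuclideanSpace ℝ (Fin N) → ℝ} {x : EuclideanSpace ℝ (Fin N)}

theorem HasTraceAt.traceFun_eq {a : ℝ} (h : HasTraceAt Ω u x a) : traceFun Ω u x = a := by
  have hex : ∃ a, HasTraceAt Ω u x a := ⟨a, h⟩
  rw [traceFun, dif_pos hex]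
  exact tendsto_nhds_unique hex.choose_spec h

theorem hasTraceAt_congr {a : ℝ} (h : u =ᵐ[volume.restrict Ω] v) :
    HasTraceAt Ω u x a ↔ HasTraceAt Ω v x a := by
  have e : ∀ r, ⨍ y in Metric.ball x r ∩ Ω, u y = ⨍ y in Metric.ball x r ∩ Ω, v y := fun r => by
    rw [setAverage_eq, setAverage_eq,
      integral_congr_ae (ae_restrict_of_ae_restrict_of_subset inter_subset_right h)]
  simp only [HasTraceAt, e]

/-- Ball averages see only the a.e. class, so the trace is well defined on elements of `Lp`. -/
theorem traceFun_congr (h : u =ᵐ[volume.restrict Ω] v) : traceFun Ω u = traceFun Ω v := by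
  funext x
  by_cases hex : ∃ a, HasTraceAt Ω u x a
  · obtain ⟨a, ha⟩ := hex
    rw [ha.traceFun_eq, ((hasTraceAt_congr h).1 ha).traceFun_eq]
  · have hex' : ¬∃ a, HasTraceAt Ω v x a := fun ⟨a, ha⟩ => hex ⟨a, (hasTraceAt_congr h).2 ha⟩
    rw [traceFun, traceFun, dif_neg hex, dif_neg hex']

theorem measure_ball_inter_ne_zero (hΩ : IsOpen Ω) (hx : x ∈ closure Ω) {r : ℝ} (hr : 0 < r) :
    volume (Metric.ball x r ∩ Ω) ≠ 0 := by
  refine ((Metric.isOpen_ball.inter hΩ).measure_pos _ ?_).ne'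
  obtain ⟨y, hy, hxy⟩ := Metric.mem_closure_iff.1 hx r hr
  exact ⟨y, by rwa [Metric.mem_ball, dist_comm], hy⟩

theorem measure_ball_inter_ne_top {r : ℝ} : volume (Metric.ball x r ∩ Ω) ≠ ∞ :=
  ne_top_of_le_ne_top measure_ball_lt_top.ne (measure_mono inter_subset_left)

theorem hasTraceAt_const (hΩ : IsOpen Ω) (hx : x ∈ closure Ω) (c : ℝ) :
    HasTraceAt Ω (fun _ => c) x c := by
  refine Tendsto.congr' ?_ tendsto_const_nhds
  filter_upwards [self_mem_nhdsWithin] with r hr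
  exact (setAverage_const (measure_ball_inter_ne_zero hΩ hx hr) measure_ball_inter_ne_top c).symm

theorem HasTraceAt.linear_combination {a b : ℝ} (hu : HasTraceAt Ω u x a) (hv : HasTraceAt Ω v x b)
    (hui : IntegrableOn u Ω) (hvi : IntegrableOn v Ω) (α β : ℝ) :
    HasTraceAt Ω (fun y => α * u y + β * v y) x (α * a + β * b) := by
  have e : ∀ r, ⨍ y in Metric.ball x r ∩ Ω, (α * u y + β * v y) =
      α * (⨍ y in Metric.ball x r ∩ Ω, u y) + β * ⨍ y in Metric.ball x r ∩ Ω, v y := fun r => by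
    have h1 := hui.mono_set (inter_subset_right (s := Metric.ball x r))
    have h2 := hvi.mono_set (inter_subset_right (s := Metric.ball x r))
    rw [setAverage_eq, setAverage_eq, setAverage_eq,
      integral_add (h1.const_mul α) (h2.const_mul β), integral_const_mul, integral_const_mul]
    simp only [smul_eq_mul]
    ring
  simp only [HasTraceAt, e]
  exact (hu.const_mul α).add (hv.const_mul β)

theorem measurable_ball_average (hΩ : MeasurableSet Ω) (hu : Measurable u) (r : ℝ) :
    Measurable fun x => ⨍ y in Metric.ball x r ∩ Ω, u y := by
  have hS : MeasurableSet {z : EuclideanSpace ℝ (Fin N) × EuclideanSpace ℝ (Fin N) |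
      z.2 ∈ Metric.ball z.1 r ∩ Ω} :=
    (measurableSet_lt (measurable_snd.dist measurable_fst) measurable_const).inter
      (measurable_snd hΩ)
  have h1 : Measurable fun x => volume (Metric.ball x r ∩ Ω) :=
    measurable_measure_prodMk_left hS
  have h2 : Measurable fun x : EuclideanSpace ℝ (Fin N) => ∫ y, {z : EuclideanSpace ℝ (Fin N) ×
      EuclideanSpace ℝ (Fin N) | z.2 ∈ Metric.ball z.1 r ∩ Ω}.indicator (fun z => u z.2) (x, y) :=
    (StronglyMeasurable.integral_prod_right'
      ((hu.comp measurable_snd).indicator hS).stronglyMeasurable).measurable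
  have e : (fun x => ⨍ y in Metric.ball x r ∩ Ω, u y) = fun x =>
      (volume (Metric.ball x r ∩ Ω)).toReal⁻¹ * ∫ y, {z : EuclideanSpace ℝ (Fin N) ×
      EuclideanSpace ℝ (Fin N) | z.2 ∈ Metric.ball z.1 r ∩ Ω}.indicator (fun z => u z.2) (x, y) := by
    funext x
    rw [setAverage_eq, ← integral_indicator (measurableSet_ball.inter hΩ)]
    rfl
  rw [e]
  exact h1.ennreal_toReal.inv.mul h2

theorem HasTraceAt.tendsto_dyadic {a R : ℝ} (hR : 0 < R) (h : HasTraceAt Ω u x a) :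
    Tendsto (fun k : ℕ => ⨍ y in Metric.ball x (R * (1 / 2) ^ k) ∩ Ω, u y) atTop (𝓝 a) := by
  refine h.comp (tendsto_nhdsWithin_iff.2 ⟨?_, Eventually.of_forall fun k => ?_⟩)
  · simpa using (tendsto_pow_atTop_nhds_zero_of_lt_one (by norm_num : (0 : ℝ) ≤ 1 / 2)
      (by norm_num)).const_mul R
  · simp only [mem_Ioi]
    positivity

/-- The trace is an a.e. limit of averages over balls of dyadic radius, each measurable in the
centre. -/
theorem aemeasurable_traceFun (hΩ : MeasurableSet Ω) (hu : Measurable u)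
    (h : ∀ᵐ x ∂μ, ∃ a, HasTraceAt Ω u x a) : AEMeasurable (traceFun Ω u) μ := by
  refine aemeasurable_of_tendsto_metrizable_ae atTop
    (fun k : ℕ => (measurable_ball_average hΩ hu (1 * (1 / 2) ^ k)).aemeasurable) ?_
  filter_upwards [h] with x ⟨a, ha⟩
  rw [ha.traceFun_eq]
  exact ha.tendsto_dyadic one_pos

/-- Geometric control of the oscillation over dyadic scales yields a limit at `0`, with a rate. -/
theorem exists_tendsto_of_dyadic_oscillation {m : ℝ → ℝ} {R M θ : ℝ} (hR : 0 < R) (hθ0 : 0 < θ)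
    (hθ1 : θ < 1) (h : ∀ (k : ℕ) (r : ℝ), R * (1 / 2) ^ (k + 1) ≤ r → r ≤ R * (1 / 2) ^ k →
      |m r - m (R * (1 / 2) ^ k)| ≤ M * θ ^ k) :
    ∃ a, Tendsto m (𝓝[>] 0) (𝓝 a) ∧ ∀ k : ℕ, |a - m (R * (1 / 2) ^ k)| ≤ M * θ ^ k / (1 - θ) := by
  set f : ℕ → ℝ := fun k => m (R * (1 / 2) ^ k) with hf
  have hstep : ∀ k, dist (f k) (f (k + 1)) ≤ M * θ ^ k := by
    intro k
    rw [dist_comm, Real.dist_eq]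
    refine h k _ le_rfl ?_
    rw [pow_succ]
    have : 0 < R * (1 / 2) ^ k := by positivity
    linarith
  obtain ⟨a, ha⟩ := cauchySeq_tendsto_of_complete (cauchySeq_of_le_geometric θ M hθ1 hstep)
  have hrate : ∀ k, |a - f k| ≤ M * θ ^ k / (1 - θ) := fun k => by
    rw [← Real.dist_eq, dist_comm]
    exact dist_le_of_le_geometric_of_tendsto θ M hθ1 hstep ha k
  have hM : 0 ≤ M := by
    have := (dist_nonneg).trans (hstep 0)
    simpa using this
  refine ⟨a, ?_, hrate⟩
  rw [Metric.tendsto_nhds]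
  intro e he
  have hlim : Tendsto (fun k : ℕ => M * θ ^ k + M * θ ^ k / (1 - θ)) atTop (𝓝 0) := by
    have h1 := (tendsto_pow_atTop_nhds_zero_of_lt_one hθ0.le hθ1).const_mul M
    simpa using h1.add (h1.div_const (1 - θ))
  obtain ⟨K, hK⟩ := eventually_atTop.1 ((tendsto_order.1 hlim).2 e he)
  have hRK : 0 < R * (1 / 2) ^ K := by positivity
  filter_upwards [Ioc_mem_nhdsGT hRK] with r hr
  have hRK1 : R * (1 / 2) ^ K ≤ R := by
    have : ((1 : ℝ) / 2) ^ K ≤ 1 := pow_le_one₀ (by norm_num) (by norm_num)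
    nlinarith
  -- Every small r lies between two consecutive dyadic radii, so the limit holds along all radii and
  -- not only the dyadic ones.
  obtain ⟨k, hk1, hk2⟩ := exists_nat_pow_near_of_lt_one (div_pos hr.1 hR)
    ((div_le_one hR).2 (hr.2.trans hRK1)) (by norm_num : (0 : ℝ) < 1 / 2) (by norm_num)
  rw [lt_div_iff₀ hR, mul_comm] at hk1
  rw [div_le_iff₀ hR, mul_comm] at hk2
  have hKk : K ≤ k := by
    by_contra! hlt
    have h2 : ((1 : ℝ) / 2) ^ K ≤ (1 / 2) ^ (k + 1) :=
      pow_le_pow_of_le_one (by norm_num) (by norm_num) hlt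
    have h3 : R * (1 / 2) ^ K ≤ R * (1 / 2) ^ (k + 1) := by gcongr
    linarith [hr.2]
  rw [Real.dist_eq]
  have h4 := h k r hk1.le hk2
  have h5 := hrate k
  rw [abs_sub_comm] at h5
  calc |m r - a| = |(m r - f k) + (f k - a)| := by ring_nf
    _ ≤ |m r - f k| + |f k - a| := abs_add_le _ _
    _ ≤ M * θ ^ k + M * θ ^ k / (1 - θ) := add_le_add h4 h5
    _ < e := hK k hKk

/-- Difference of two averages of a function in terms of the Gagliardo kernel. -/
theorem abs_setAverage_sub_setAverage_rpow_le {a : ℝ} (hp : 1 ≤ p) (ha : 0 ≤ a)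
    (hu : Measurable u) (hint : IntegrableOn u Ω) {ρ : ℝ}
    {B₁ B₂ : Set (EuclideanSpace ℝ (Fin N))} (hB₁ : B₁ ⊆ Metric.ball x ρ ∩ Ω)
    (hB₂ : B₂ ⊆ Metric.ball x ρ ∩ Ω) (hm₁ : MeasurableSet B₁) (hm₂ : MeasurableSet B₂)
    {b₁ b₂ : ℝ} (hb₁ : 0 < b₁) (hb₂ : 0 < b₂)
    (hv₁ : ENNReal.ofReal b₁ ≤ volume B₁) (hv₂ : ENNReal.ofReal b₂ ≤ volume B₂) :
    ENNReal.ofReal (|(⨍ y in B₁, u y) - ⨍ y in B₂, u y| ^ p) ≤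
      ENNReal.ofReal (b₁⁻¹ * (b₂⁻¹ * (2 * ρ) ^ a)) *
        ∫⁻ y in Metric.ball x ρ ∩ Ω, ∫⁻ z in Ω, gagliardoKernel p a u y z := by
  have ht₁ : volume B₁ ≠ ∞ := ne_top_of_le_ne_top measure_ball_inter_ne_top (measure_mono hB₁)
  have ht₂ : volume B₂ ≠ ∞ := ne_top_of_le_ne_top measure_ball_inter_ne_top (measure_mono hB₂)
  set K := fun y => ∫⁻ z in Ω, gagliardoKernel p a u y z with hK
  have hKm : Measurable K := measurable_lintegral_gagliardoKernel hu
  have h1 : ∀ y ∈ B₁, ENNReal.ofReal (|u y - ⨍ z in B₂, u z| ^ p) ≤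
      ENNReal.ofReal (b₂⁻¹ * (2 * ρ) ^ a) * K y := by
    intro y hy
    rw [abs_sub_comm]
    refine (ofReal_abs_setAverage_sub_rpow_le (measure_ne_zero_of_ofReal_le hb₂ hv₂) ht₂
      (hint.mono_set (hB₂.trans inter_subset_right)) hp (u y)).trans ?_
    rw [ENNReal.ofReal_mul (by positivity), mul_assoc]
    refine mul_le_mul' (inv_measure_le hb₂ hv₂) ?_
    rw [← lintegral_const_mul _ (measurable_gagliardoKernel_right hu y)]
    refine (setLIntegral_mono' hm₂ fun z hz => ?_).trans
      (lintegral_mono_set (hB₂.trans inter_subset_right))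
    rw [abs_sub_comm]
    refine ofReal_abs_rpow_le_kernel (by linarith) ha ?_
    have hy' := (hB₁ hy).1
    have hz' := (hB₂ hz).1
    rw [Metric.mem_ball] at hy' hz'
    rw [← dist_eq_norm]
    linarith [dist_triangle_right y z x]
  refine (ofReal_abs_setAverage_sub_rpow_le (measure_ne_zero_of_ofReal_le hb₁ hv₁) ht₁
      (hint.mono_set (hB₁.trans inter_subset_right)) hp _).trans ?_
  rw [ENNReal.ofReal_mul (by positivity), mul_assoc]
  refine mul_le_mul' (inv_measure_le hb₁ hv₁) ?_
  rw [← lintegral_const_mul _ hKm]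
  exact (setLIntegral_mono' hm₁ h1).trans (lintegral_mono_set hB₁)

/-- The upper Ahlfors bound for balls with arbitrary centres. -/
theorem restrict_ball_le_of_ahlfors {c₂ : ℝ}
    (hμ : ∀ x ∈ F, ∀ r : ℝ, 0 < r → r ≤ 1 → μ (Metric.ball x r ∩ F) ≤ ENNReal.ofReal (c₂ * r ^ d))
    (y : EuclideanSpace ℝ (Fin N)) {ρ : ℝ} (hρ : 0 < ρ) (hρ1 : ρ ≤ 1 / 2) :
    μ.restrict F (Metric.ball y ρ) ≤ ENNReal.ofReal (c₂ * (2 * ρ) ^ d) := by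
  rw [Measure.restrict_apply measurableSet_ball]
  rcases (Metric.ball y ρ ∩ F).eq_empty_or_nonempty with h | ⟨x, hx, hxF⟩
  · simp [h]
  · refine le_trans (measure_mono (inter_subset_inter_left F ?_))
      (hμ x hxF (2 * ρ) (by linarith) (by linarith))
    refine Metric.ball_subset_ball' ?_
    rw [Metric.mem_ball, dist_comm] at hx
    linarith

/-- Tonelli: y ∈ B(x, ρ) iff x ∈ B(y, ρ), so integrating in x first leaves the μ-measure of a ball
around y. -/
theorem lintegral_lintegral_ball_le [SFinite (μ.restrict F)] {c : ℝ≥0∞} {ρ : ℝ}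
    (hμ : ∀ y, μ.restrict F (Metric.ball y ρ) ≤ c)
    {g : EuclideanSpace ℝ (Fin N) → ℝ≥0∞} (hg : Measurable g) :
    ∫⁻ x in F, (∫⁻ y in Metric.ball x ρ ∩ Ω, g y) ∂μ ≤ c * ∫⁻ y in Ω, g y := by
  have hS : MeasurableSet {z : EuclideanSpace ℝ (Fin N) × EuclideanSpace ℝ (Fin N) |
      z.2 ∈ Metric.ball z.1 ρ} :=
    measurableSet_lt (measurable_snd.dist measurable_fst) measurable_const
  set h : EuclideanSpace ℝ (Fin N) → EuclideanSpace ℝ (Fin N) → ℝ≥0∞ := fun x y =>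
    {z : EuclideanSpace ℝ (Fin N) × EuclideanSpace ℝ (Fin N) |
      z.2 ∈ Metric.ball z.1 ρ}.indicator (fun z => g z.2) (x, y) with hh
  have hm : Measurable (Function.uncurry h) := (hg.comp measurable_snd).indicator hS
  have e1 : ∀ x, ∫⁻ y in Metric.ball x ρ ∩ Ω, g y = ∫⁻ y in Ω, h x y := fun x => by
    rw [← Measure.restrict_restrict measurableSet_ball, ← lintegral_indicator measurableSet_ball]
    rfl
  simp_rw [e1]
  rw [lintegral_lintegral_swap hm.aemeasurable, ← lintegral_const_mul _ hg]
  refine lintegral_mono fun y => ?_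
  have e2 : ∀ x, h x y = (Metric.ball y ρ).indicator (fun _ => g y) x := fun x => by
    simp only [hh, indicator, mem_ofPred_eq, Metric.mem_ball, dist_comm]
  simp_rw [e2]
  rw [lintegral_indicator_const measurableSet_ball, mul_comm]
  gcongr
  exact hμ y

/-- Existence of traces, with a quantitative approximation by averages over small balls. -/
theorem exists_trace_estimate {c c₂ R : ℝ} [SFinite (μ.restrict F)] (hp : 1 < p) (hs : 0 < s)
    (hd : N - d < s * p) (hΩm : MeasurableSet Ω) (hF : MeasurableSet F) (hFΩ : F ⊆ closure Ω)
    (hc : 0 < c) (hc₂ : 0 < c₂) (hR : 0 < R) (hR1 : R ≤ 1 / 2)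
    (hdens : ∀ x ∈ closure Ω, ∀ r : ℝ, 0 < r → r ≤ R →
      ENNReal.ofReal (c * r ^ (N : ℝ)) ≤ volume (Metric.ball x r ∩ Ω))
    (hμ : ∀ x ∈ F, ∀ r : ℝ, 0 < r → r ≤ 1 →
      μ (Metric.ball x r ∩ F) ≤ ENNReal.ofReal (c₂ * r ^ d)) :
    ∃ C θ : ℝ, 0 ≤ C ∧ 0 < θ ∧ θ < 1 ∧ ∀ u : EuclideanSpace ℝ (Fin N) → ℝ, Measurable u →
      IntegrableOn u Ω → interiorEnergy Ω s p u < ∞ →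
      (∀ᵐ x ∂(μ.restrict F), ∃ a, HasTraceAt Ω u x a) ∧
      ∀ k : ℕ, ∫⁻ x in F, ENNReal.ofReal
          (|traceFun Ω u x - ⨍ y in Metric.ball x (R * (1 / 2) ^ k) ∩ Ω, u y| ^ p) ∂μ ≤
        ENNReal.ofReal (C * θ ^ k) * interiorEnergy Ω s p u := by
  have hp0 : 0 < p := by linarith
  have ha : 0 ≤ N + s * p := by positivity
  -- The available gain is ρ^(2α). Half of it makes the series defining `G` integrable over F; the
  -- other half gives the geometric rate θ.
  set α := (s * p + d - N) / 2 with hα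
  have hα0 : 0 < α := by
    rw [hα]
    linarith
  set θ : ℝ := (1 / 2) ^ α with hθ
  have hθ0 : 0 < θ := by positivity
  have hθ1 : θ < 1 := Real.rpow_lt_one (by norm_num) (by norm_num) hα0
  set t : ℝ := θ ^ (1 / p) with ht
  have ht0 : 0 < t := by positivity
  have ht1 : t < 1 := Real.rpow_lt_one hθ0.le hθ1 (by positivity)
  have htp : t ^ p = θ := by
    rw [ht, ← Real.rpow_mul hθ0.le, one_div_mul_cancel hp0.ne', Real.rpow_one]
  set ρ : ℕ → ℝ := fun k => R * (1 / 2) ^ k with hρ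
  have hρ0 : ∀ k, 0 < ρ k := fun k => by positivity
  have hρR : ∀ k, ρ k ≤ R := fun k => by
    have : ((1 : ℝ) / 2) ^ k ≤ 1 := pow_le_one₀ (by norm_num) (by norm_num)
    simp only [hρ]
    nlinarith
  have hρα : ∀ k, ρ k ^ α = R ^ α * θ ^ k := fun k => by
    simp only [hρ]
    rw [Real.mul_rpow hR.le (by positivity), hθ, ← Real.rpow_natCast, ← Real.rpow_natCast,
      ← Real.rpow_mul (by norm_num), ← Real.rpow_mul (by norm_num), mul_comm (k : ℝ)]
  set C₁ : ℝ := c⁻¹ * c⁻¹ * 2 ^ (2 * N + s * p) with hC₁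
  have hC₁0 : 0 < C₁ := by positivity
  set C₂ : ℝ := c₂ * 2 ^ d * R ^ α * (1 - θ)⁻¹ with hC₂
  have h1θ : 0 < 1 - θ := by linarith
  have h1t : 0 < 1 - t := by linarith
  have hC₂0 : 0 ≤ C₂ := by positivity
  refine ⟨C₁ * R ^ α * ((1 - t)⁻¹) ^ p * C₂, θ, by positivity, hθ0, hθ1,
    fun u hu hint hE => ?_⟩
  set E := interiorEnergy Ω s p u with hEdef
  set K := fun y => ∫⁻ z in Ω, gagliardoKernel p (N + s * p) u y z with hK
  have hKm : Measurable K := measurable_lintegral_gagliardoKernel hu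
  have hEK : E = ∫⁻ y in Ω, K y := rfl
  set H : ℕ → EuclideanSpace ℝ (Fin N) → ℝ≥0∞ := fun k x =>
    ∫⁻ y in Metric.ball x (ρ k) ∩ Ω, K y with hH
  have hHm : ∀ k, Measurable (H k) := by
    intro k
    have hS : MeasurableSet {z : EuclideanSpace ℝ (Fin N) × EuclideanSpace ℝ (Fin N) |
        z.2 ∈ Metric.ball z.1 (ρ k) ∩ Ω} :=
      (measurableSet_lt (measurable_snd.dist measurable_fst) measurable_const).inter
        (measurable_snd hΩm)
    have h1 : Measurable fun x : EuclideanSpace ℝ (Fin N) => ∫⁻ y, {z : EuclideanSpace ℝ (Fin N) ×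
        EuclideanSpace ℝ (Fin N) | z.2 ∈ Metric.ball z.1 (ρ k) ∩ Ω}.indicator
          (fun z => K z.2) (x, y) :=
      Measurable.lintegral_prod_right' ((hKm.comp measurable_snd).indicator hS)
    refine (congrArg Measurable (funext fun x => ?_)).mp h1
    simp only [hH]
    rw [← lintegral_indicator (measurableSet_ball.inter hΩm)]
    rfl
  set G : EuclideanSpace ℝ (Fin N) → ℝ≥0∞ := fun x =>
    ∑' k, ENNReal.ofReal (ρ k ^ (s * p - N - α)) * H k x with hG
  have hGint : ∫⁻ x in F, G x ∂μ ≤ ENNReal.ofReal C₂ * E := by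
    simp only [hG]
    rw [lintegral_tsum fun k => ((hHm k).const_mul _).aemeasurable]
    have h1 : ∀ k, ∫⁻ x in F, ENNReal.ofReal (ρ k ^ (s * p - N - α)) * H k x ∂μ ≤
        ENNReal.ofReal (c₂ * 2 ^ d * R ^ α * θ ^ k) * E := by
      intro k
      rw [lintegral_const_mul _ (hHm k)]
      have h2 : ∫⁻ x in F, H k x ∂μ ≤ ENNReal.ofReal (c₂ * (2 * ρ k) ^ d) * ∫⁻ y in Ω, K y :=
        lintegral_lintegral_ball_le (μ := μ) (F := F) (fun y =>
        restrict_ball_le_of_ahlfors hμ y (hρ0 k) ((hρR k).trans hR1)) hKm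
      refine (mul_le_mul_right h2 _).trans (le_of_eq ?_)
      rw [← mul_assoc, ← ENNReal.ofReal_mul (by have := hρ0 k; positivity), hEK]
      congr 2
      rw [Real.mul_rpow (by norm_num) (hρ0 k).le]
      calc ρ k ^ (s * p - N - α) * (c₂ * (2 ^ d * ρ k ^ d))
          = c₂ * 2 ^ d * (ρ k ^ (s * p - N - α) * ρ k ^ d) := by ring
        _ = c₂ * 2 ^ d * ρ k ^ α := by
          rw [← Real.rpow_add (hρ0 k)]
          congr 2
          rw [hα]
          ring
        _ = _ := by
          rw [hρα]
          ring
    refine (ENNReal.tsum_le_tsum h1).trans ?_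
    rw [ENNReal.tsum_mul_right, ← ENNReal.ofReal_tsum_of_nonneg (fun k => by positivity)
      ((summable_geometric_of_lt_one hθ0.le hθ1).mul_left _), tsum_mul_left,
      tsum_geometric_of_lt_one hθ0.le hθ1]
  have hGm : Measurable G := Measurable.tsum fun k => (hHm k).const_mul _
  have hGfin : ∀ᵐ x ∂(μ.restrict F), G x < ∞ :=
    ae_lt_top hGm (hGint.trans_lt (ENNReal.mul_lt_top ENNReal.ofReal_lt_top hE)).ne
  have key : ∀ᵐ x ∂(μ.restrict F), (∃ a, HasTraceAt Ω u x a) ∧ ∀ k : ℕ,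
      ENNReal.ofReal (|traceFun Ω u x - ⨍ y in Metric.ball x (ρ k) ∩ Ω, u y| ^ p) ≤
        ENNReal.ofReal (C₁ * R ^ α * ((1 - t)⁻¹) ^ p * θ ^ k) * G x := by
    filter_upwards [hGfin, ae_restrict_mem hF] with x hx hxF
    -- Both balls lie in B(x, ρ k) and have volume at least of order (ρ k)^N, so the p-th power of
    -- the difference is at most C₁ (ρ k)^(sp - N) H k x ≤ C₁ (ρ k)^α G x. Taking the p-th root
    -- turns θ into t.
    have hosc : ∀ (k : ℕ) (r : ℝ), R * (1 / 2) ^ (k + 1) ≤ r → r ≤ R * (1 / 2) ^ k →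
        |(⨍ y in Metric.ball x r ∩ Ω, u y) - ⨍ y in Metric.ball x (R * (1 / 2) ^ k) ∩ Ω, u y| ≤
          (C₁ * R ^ α * (G x).toReal) ^ (1 / p) * t ^ k := by
      intro k r hr1 hr2
      have hk0 := hρ0 k
      have hr1' : ρ k / 2 ≤ r := by
        refine le_trans (le_of_eq ?_) hr1
        simp only [hρ, pow_succ]
        ring
      have hr0 : 0 < r := by linarith
      have hb₁ : ENNReal.ofReal (c * (ρ k / 2) ^ (N : ℝ)) ≤ volume (Metric.ball x r ∩ Ω) := by
        refine le_trans (ENNReal.ofReal_le_ofReal ?_)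
          (hdens x (hFΩ hxF) r hr0 (hr2.trans (hρR k)))
        gcongr
      have h1 := abs_setAverage_sub_setAverage_rpow_le (x := x) hp.le ha hu hint
        (inter_subset_inter_left Ω (Metric.ball_subset_ball hr2)) Subset.rfl
        (measurableSet_ball.inter hΩm) (measurableSet_ball.inter hΩm) (by positivity)
        (by positivity) hb₁ (hdens x (hFΩ hxF) (ρ k) (hρ0 k) (hρR k))
      have h2 : ENNReal.ofReal (ρ k ^ (s * p - N - α)) * H k x ≤ G x :=
        ENNReal.le_tsum (f := fun k => ENNReal.ofReal (ρ k ^ (s * p - N - α)) * H k x) k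
      have e : (c * (ρ k / 2) ^ (N : ℝ))⁻¹ * ((c * ρ k ^ (N : ℝ))⁻¹ * (2 * ρ k) ^ (N + s * p)) =
          C₁ * ρ k ^ α * ρ k ^ (s * p - N - α) := by
        have e1 : ρ k ^ (N + s * p) = ρ k ^ (N : ℝ) * ρ k ^ (N : ℝ) *
            (ρ k ^ α * ρ k ^ (s * p - N - α)) := by
          rw [← Real.rpow_add hk0, ← Real.rpow_add hk0, ← Real.rpow_add hk0]
          congr 1
          ring
        have e2 : (2 : ℝ) ^ (2 * N + s * p) = 2 ^ (N : ℝ) * 2 ^ (N + s * p) := by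
          rw [← Real.rpow_add two_pos]
          congr 1
          ring
        rw [Real.mul_rpow two_pos.le hk0.le, Real.div_rpow hk0.le two_pos.le, e1, hC₁, e2]
        field_simp
      have h3 : ENNReal.ofReal (|(⨍ y in Metric.ball x r ∩ Ω, u y) -
          ⨍ y in Metric.ball x (ρ k) ∩ Ω, u y| ^ p) ≤ ENNReal.ofReal (C₁ * ρ k ^ α) * G x := by
        refine h1.trans ?_
        rw [e, ENNReal.ofReal_mul (by positivity), mul_assoc]
        exact mul_le_mul_right h2 _
      rw [← ENNReal.ofReal_toReal hx.ne, ← ENNReal.ofReal_mul (by positivity),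
        ENNReal.ofReal_le_ofReal_iff (by positivity)] at h3
      have h4 : C₁ * ρ k ^ α * (G x).toReal =
          ((C₁ * R ^ α * (G x).toReal) ^ (1 / p) * t ^ k) ^ p := by
        rw [Real.mul_rpow (show 0 ≤ (C₁ * R ^ α * (G x).toReal) ^ (1 / p) by positivity)
          (show 0 ≤ t ^ k by positivity), ← Real.rpow_mul (by positivity),
          one_div_mul_cancel hp0.ne', Real.rpow_one, ← Real.rpow_natCast t k, ← Real.rpow_mul ht0.le,
          mul_comm (k : ℝ) p, Real.rpow_mul ht0.le, htp, Real.rpow_natCast, hρα]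
        ring
      rw [h4] at h3
      exact (Real.rpow_le_rpow_iff (abs_nonneg _) (by positivity) hp0).1 h3
    obtain ⟨a, haT, hrate⟩ := exists_tendsto_of_dyadic_oscillation hR ht0 ht1 hosc
    have haT' : HasTraceAt Ω u x a := haT
    refine ⟨⟨a, haT'⟩, fun k => ?_⟩
    rw [haT'.traceFun_eq, ← ENNReal.ofReal_toReal hx.ne, ← ENNReal.ofReal_mul (by positivity)]
    refine ENNReal.ofReal_le_ofReal ?_
    refine (Real.rpow_le_rpow (abs_nonneg _) (hrate k) hp0.le).trans (le_of_eq ?_)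
    rw [div_eq_mul_inv, Real.mul_rpow (by positivity) (by positivity),
      Real.mul_rpow (by positivity) (by positivity), ← Real.rpow_mul (by positivity),
      one_div_mul_cancel hp0.ne', Real.rpow_one, ← Real.rpow_natCast t k, ← Real.rpow_mul ht0.le,
      mul_comm (k : ℝ) p, Real.rpow_mul ht0.le, htp, Real.rpow_natCast]
    ring
  refine ⟨key.mono fun x hx => hx.1, fun k => ?_⟩
  refine (lintegral_mono_ae (key.mono fun x hx => hx.2 k)).trans ?_
  rw [lintegral_const_mul _ hGm]
  refine (mul_le_mul_right hGint _).trans (le_of_eq ?_)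
  rw [← mul_assoc, ← ENNReal.ofReal_mul (by positivity)]
  congr 2
  ring

end Trace

/-! ### Minimisation of convex functionals on a Hilbert space -/

section Minimisation

variable {H : Type*} [NormedAddCommGroup H] [InnerProductSpace ℝ H] [CompleteSpace H]

/-- A decreasing sequence of non-empty, closed, convex, bounded subsets of a Hilbert space has
non-empty intersection. -/
theorem nonempty_iInter_of_convex_closed_bounded {C : ℕ → Set H} (hanti : Antitone C)
    (hne : ∀ n, (C n).Nonempty) (hcl : ∀ n, IsClosed (C n)) (hconv : ∀ n, Convex ℝ (C n)) {B : ℝ}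
    (hB : ∀ x ∈ C 0, ‖x‖ ≤ B) : (⋂ n, C n).Nonempty := by
  -- The points of least norm in the C n have increasing bounded norms; by the parallelogram law
  -- they form a Cauchy sequence, whose limit lies in every C n. This takes the place of weak
  -- compactness.
  have hmin : ∀ n, ∃ x ∈ C n, ∀ y ∈ C n, ‖x‖ ≤ ‖y‖ := by
    intro n
    obtain ⟨x, hx, hxe⟩ := exists_norm_eq_iInf_of_complete_convex (hne n) (hcl n).isComplete
      (hconv n) 0
    refine ⟨x, hx, fun y hy => ?_⟩
    have h1 : ⨅ w : C n, ‖(0 : H) - w‖ ≤ ‖(0 : H) - y‖ :=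
      ciInf_le ⟨0, by rintro _ ⟨w, rfl⟩; positivity⟩ (⟨y, hy⟩ : C n)
    rw [← hxe] at h1
    simpa using h1
  choose x hx hxm using hmin
  have hmono : Monotone fun n => ‖x n‖ ^ 2 := fun m n hmn => by
    have := hxm m (x n) (hanti hmn (hx n))
    dsimp only
    gcongr
  have hbdd : BddAbove (range fun n => ‖x n‖ ^ 2) := by
    refine ⟨B ^ 2, ?_⟩
    rintro _ ⟨n, rfl⟩
    have := hB (x n) (hanti (Nat.zero_le n) (hx n))
    dsimp only
    gcongr
  have hlim := tendsto_atTop_ciSup hmono hbdd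
  set l := ⨆ n, ‖x n‖ ^ 2 with hl
  have hpar : ∀ m n, m ≤ n → ‖x m - x n‖ ^ 2 ≤ 2 * (l - ‖x m‖ ^ 2) := by
    intro m n hmn
    have h1 : ‖x m‖ ≤ ‖(1 / 2 : ℝ) • x m + (1 / 2 : ℝ) • x n‖ :=
      hxm m _ (hconv m (hx m) (hanti hmn (hx n)) (by norm_num) (by norm_num) (by norm_num))
    have h2 : ‖(1 / 2 : ℝ) • x m + (1 / 2 : ℝ) • x n‖ = ‖x m + x n‖ / 2 := by
      rw [← smul_add, norm_smul]
      norm_num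
      ring
    have h3 := parallelogram_law_with_norm ℝ (x m) (x n)
    have h4 : ‖x n‖ ^ 2 ≤ l := le_ciSup hbdd n
    rw [h2] at h1
    have h5 : (2 * ‖x m‖) ^ 2 ≤ ‖x m + x n‖ ^ 2 := by
      gcongr
      linarith
    nlinarith
  have hcau : CauchySeq x := by
    refine Metric.cauchySeq_iff'.2 fun e he => ?_
    obtain ⟨n, hn⟩ := ((tendsto_order.1 hlim).1 (l - e ^ 2 / 2)
      (by have : 0 < e ^ 2 := by positivity
          linarith)).exists
    refine ⟨n, fun k hk => ?_⟩
    rw [dist_comm, dist_eq_norm]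
    have h6 := hpar n k hk
    refine lt_of_pow_lt_pow_left₀ 2 he.le ?_
    linarith
  obtain ⟨y, hy⟩ := cauchySeq_tendsto_of_complete hcau
  refine ⟨y, mem_iInter.2 fun n => (hcl n).mem_of_tendsto hy ?_⟩
  filter_upwards [eventually_ge_atTop n] with k hk
  exact hanti hk (hx k)

/-- For t ≥ 1 the right-hand side is at most C (1 + b) t, and p > 1 lets one factor t be cancelled.
This bounds the sublevel sets of the linearly perturbed functional. -/
theorem le_of_rpow_le_mul_one_add {p C b t : ℝ} (hp : 1 < p) (hC : 0 ≤ C) (ht : 0 ≤ t)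
    (h : t ^ p ≤ C * (1 + b * t)) : t ≤ max 1 ((C * (1 + b)) ^ (1 / (p - 1))) := by
  rcases le_total t 1 with h1 | h1
  · exact h1.trans (le_max_left _ _)
  refine le_max_of_le_right ?_
  have ht0 : 0 < t := by linarith
  have h2 : t ^ (p - 1) ≤ C * (1 + b) := by
    rw [Real.rpow_sub_one ht0.ne', div_le_iff₀ ht0]
    refine h.trans ?_
    rw [mul_assoc]
    refine mul_le_mul_of_nonneg_left ?_ hC
    linarith
  calc t = (t ^ (p - 1)) ^ (1 / (p - 1)) := by
        rw [← Real.rpow_mul ht, mul_one_div_cancel (by linarith), Real.rpow_one]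
    _ ≤ _ := by
        gcongr

/-- The direct method: a convex, lower semicontinuous functional that is coercive (with an exponent
`p > 1`) on a closed subspace attains the minimum of its perturbation by any linear functional. -/
theorem exists_minimiser_of_coercive {Φ : H → ℝ≥0∞} (h0 : Φ 0 = 0)
    (hconv : ∀ u v : H, ∀ α β : ℝ, 0 ≤ α → 0 ≤ β → α + β = 1 →
      Φ (α • u + β • v) ≤ ENNReal.ofReal α * Φ u + ENNReal.ofReal β * Φ v)
    (hlsc : ∀ (u : ℕ → H) (v : H) (M : ℝ), Tendsto u atTop (𝓝 v) →
      (∀ n, Φ (u n) ≤ ENNReal.ofReal M) → Φ v ≤ ENNReal.ofReal M)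
    (K : Submodule ℝ H) (hK : IsClosed (K : Set H)) {p C : ℝ} (hp : 1 < p) (hC : 0 ≤ C)
    (hcoer : ∀ v ∈ K, Φ v < ∞ → ‖v‖ ^ p ≤ C * (Φ v).toReal) (f : H) :
    ∃ u ∈ K, Φ u < ∞ ∧ ∀ v ∈ K, Φ v < ∞ →
      (Φ u).toReal + inner ℝ f (v - u) ≤ (Φ v).toReal := by
  set J : H → ℝ := fun v => (Φ v).toReal - inner ℝ f v with hJ
  set D : Set H := {v | v ∈ K ∧ Φ v < ∞} with hD
  set B := max 1 ((C * (1 + ‖f‖)) ^ (1 / (p - 1))) with hB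
  have hbd : ∀ v ∈ D, J v ≤ 1 → ‖v‖ ≤ B := by
    rintro v ⟨hvK, hv⟩ hJv
    refine le_of_rpow_le_mul_one_add hp hC (norm_nonneg v) ?_
    refine (hcoer v hvK hv).trans (mul_le_mul_of_nonneg_left ?_ hC)
    have := real_inner_le_norm f v
    simp only [hJ] at hJv
    linarith
  have h0D : (0 : H) ∈ D := ⟨K.zero_mem, by simp [h0]⟩
  have hJ0 : J 0 = 0 := by simp [hJ, h0]
  have hbelow : BddBelow (J '' D) := by
    refine ⟨min 1 (-(‖f‖ * B)), ?_⟩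
    rintro _ ⟨v, hv, rfl⟩
    rcases le_total (J v) 1 with h1 | h1
    · refine (min_le_right _ _).trans ?_
      have h2 := real_inner_le_norm f v
      have h3 : ‖f‖ * ‖v‖ ≤ ‖f‖ * B := by
        gcongr
        exact hbd v hv h1
      have h4 : 0 ≤ (Φ v).toReal := ENNReal.toReal_nonneg
      simp only [hJ]
      linarith
    · exact (min_le_left _ _).trans h1
  set m := sInf (J '' D) with hm
  have hm0 : m ≤ 0 := by
    rw [← hJ0]
    exact csInf_le hbelow ⟨0, h0D, rfl⟩
  -- Almost-minimising sets: closed by lower semicontinuity, convex by convexity, bounded by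
  -- coercivity. A common point is a minimiser.
  set S : ℕ → Set H := fun n => {v | v ∈ D ∧ J v ≤ m + 1 / ((n : ℝ) + 1)} with hS
  have hS1 : ∀ n : ℕ, 1 / ((n : ℝ) + 1) ≤ 1 := fun n => by
    rw [div_le_one (by positivity)]
    have : (0 : ℝ) ≤ n := Nat.cast_nonneg n
    linarith
  have hne : (⋂ n, S n).Nonempty := by
    refine nonempty_iInter_of_convex_closed_bounded (B := B) ?_ ?_ ?_ ?_ ?_
    · rintro i j hij v ⟨hv, hvJ⟩
      refine ⟨hv, hvJ.trans ?_⟩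
      have := Nat.one_div_le_one_div (α := ℝ) hij
      linarith
    · intro n
      obtain ⟨_, ⟨v, hv, rfl⟩, hlt⟩ := exists_lt_of_csInf_lt (Set.Nonempty.image J ⟨0, h0D⟩)
        (show sInf (J '' D) < m + 1 / ((n : ℝ) + 1) by
          have : 0 < 1 / ((n : ℝ) + 1) := by positivity
          linarith)
      exact ⟨v, hv, hlt.le⟩
    · intro n
      refine IsSeqClosed.isClosed fun u v hu huv => ?_
      set t := m + 1 / ((n : ℝ) + 1) with ht
      have hin : Tendsto (fun k => inner ℝ f (u k)) atTop (𝓝 (inner ℝ f v)) :=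
        (tendsto_const_nhds).inner huv
      -- The bound on Φ along the sequence involves ⟨f, u k⟩, which only converges; the slack e
      -- yields a uniform bound on a tail, as `hlsc` requires.
      have key : ∀ e : ℝ, 0 < e → Φ v < ∞ ∧ (Φ v).toReal ≤ t + inner ℝ f v + e := by
        intro e he
        obtain ⟨k, hk⟩ := eventually_atTop.1 ((tendsto_order.1 hin).2 (inner ℝ f v + e)
          (by linarith))
        have hle : ∀ j, Φ (u (j + k)) ≤ ENNReal.ofReal (t + inner ℝ f v + e) := by
          intro j
          have h1 := (hu (j + k)).2
          have h2 := hk (j + k) (Nat.le_add_left _ _)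
          rw [← ENNReal.ofReal_toReal (hu (j + k)).1.2.ne]
          refine ENNReal.ofReal_le_ofReal ?_
          simp only [hJ] at h1
          linarith
        have h3 := hlsc _ v _ (huv.comp (tendsto_add_atTop_nat k)) hle
        refine ⟨h3.trans_lt ENNReal.ofReal_lt_top, ENNReal.toReal_le_of_le_ofReal ?_ h3⟩
        have h1 := (hu k).2
        have h2 := hk k le_rfl
        have h4 : 0 ≤ (Φ (u k)).toReal := ENNReal.toReal_nonneg
        simp only [hJ] at h1
        linarith
      refine ⟨⟨hK.mem_of_tendsto huv (Eventually.of_forall fun k => (hu k).1.1),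
        (key 1 one_pos).1⟩, ?_⟩
      have := le_of_forall_pos_le_add fun e he => (key e he).2
      simp only [hJ]
      linarith
    · rintro n u ⟨⟨huK, hu⟩, huJ⟩ v ⟨⟨hvK, hv⟩, hvJ⟩ α β hα hβ hαβ
      have h1 := hconv u v α β hα hβ hαβ
      have h2 : ENNReal.ofReal α * Φ u + ENNReal.ofReal β * Φ v < ∞ :=
        ENNReal.add_lt_top.2 ⟨ENNReal.mul_lt_top ENNReal.ofReal_lt_top hu,
          ENNReal.mul_lt_top ENNReal.ofReal_lt_top hv⟩
      refine ⟨⟨K.add_mem (K.smul_mem _ huK) (K.smul_mem _ hvK), h1.trans_lt h2⟩, ?_⟩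
      have h3 := ENNReal.toReal_mono h2.ne h1
      rw [ENNReal.toReal_add (ENNReal.mul_lt_top ENNReal.ofReal_lt_top hu).ne
        (ENNReal.mul_lt_top ENNReal.ofReal_lt_top hv).ne, ENNReal.toReal_mul, ENNReal.toReal_mul,
        ENNReal.toReal_ofReal hα, ENNReal.toReal_ofReal hβ] at h3
      simp only [hJ, inner_add_right, real_inner_smul_right] at huJ hvJ ⊢
      have h4 := mul_le_mul_of_nonneg_left huJ hα
      have h5 := mul_le_mul_of_nonneg_left hvJ hβ
      have h6 : α * (m + 1 / ((n : ℝ) + 1)) + β * (m + 1 / ((n : ℝ) + 1))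
          = m + 1 / ((n : ℝ) + 1) := by rw [← add_mul, hαβ, one_mul]
      linarith
    · rintro v ⟨hv, hvJ⟩
      refine hbd v hv (hvJ.trans ?_)
      have := hS1 0
      linarith
  obtain ⟨u, hu⟩ := hne
  rw [mem_iInter] at hu
  have hum : J u ≤ m := by
    refine ge_of_tendsto' (x := atTop) (f := fun n : ℕ => m + 1 / ((n : ℝ) + 1)) ?_
      fun n => (hu n).2
    simpa using tendsto_const_nhds.add (tendsto_one_div_add_atTop_nhds_zero_nat (𝕜 := ℝ))
  refine ⟨u, (hu 0).1.1, (hu 0).1.2, fun v hvK hv => ?_⟩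
  have h1 : m ≤ J v := csInf_le hbelow ⟨v, ⟨hvK, hv⟩, rfl⟩
  simp only [hJ] at hum h1
  rw [inner_sub_right]
  linarith

end Minimisation

/-! ### The energy functional -/

/-- Superadditivity of liminf, in the form that combines the two separate Fatou bounds. -/
theorem mul_liminf_add_mul_liminf_le {f g : ℕ → ℝ≥0∞} {a b M : ℝ≥0∞}
    (h : ∀ n, a * f n + b * g n ≤ M) : a * liminf f atTop + b * liminf g atTop ≤ M := by
  rw [liminf_eq_iSup_iInf_of_nat, liminf_eq_iSup_iInf_of_nat, ENNReal.mul_iSup, ENNReal.mul_iSup,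
    ENNReal.iSup_add_iSup_of_monotone]
  · refine iSup_le fun n => le_trans ?_ (h n)
    gcongr
    · exact iInf₂_le n le_rfl
    · exact iInf₂_le n le_rfl
  · intro m n hmn
    dsimp only
    gcongr
    exact le_iInf fun hi => iInf_le_of_le (hmn.trans hi) le_rfl
  · intro m n hmn
    dsimp only
    gcongr
    exact le_iInf fun hi => iInf_le_of_le (hmn.trans hi) le_rfl

theorem measure_lt_top_of_ahlfors {N : ℕ} {F : Set (EuclideanSpace ℝ (Fin N))}
    {μ : Measure (EuclideanSpace ℝ (Fin N))} {c₂ d : ℝ} (hF : IsCompact F)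
    (hμ : ∀ x ∈ F, ∀ r : ℝ, 0 < r → r ≤ 1 →
      μ (Metric.ball x r ∩ F) ≤ ENNReal.ofReal (c₂ * r ^ d)) : μ F < ∞ :=
  hF.measure_lt_top_of_nhdsWithin fun x hx => ⟨Metric.ball x 1 ∩ F,
    inter_mem (mem_nhdsWithin_of_mem_nhds (Metric.ball_mem_nhds x one_pos)) self_mem_nhdsWithin,
    (hμ x hx 1 one_pos le_rfl).trans_lt ENNReal.ofReal_lt_top⟩

/-- The analytic properties of a domain and of a measure on its boundary on which the study of the
functional `Psi` rests. -/
structure IsEnergySetting {N : ℕ} (Ω : Set (EuclideanSpace ℝ (Fin N)))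
    (μ : Measure (EuclideanSpace ℝ (Fin N))) (d s η p q : ℝ) : Prop where
  isOpen : IsOpen Ω
  nonempty : Ω.Nonempty
  bounded : Bornology.IsBounded Ω
  boundary_finite : μ (frontier Ω) < ∞
  one_lt_p : 1 < p
  one_lt_q : 1 < q
  s_pos : 0 < s
  exponent_nonneg : 0 ≤ d + η * q
  trace : ∃ C θ R : ℝ, 0 ≤ C ∧ 0 < θ ∧ θ < 1 ∧
    -- The bound b depends on the scale k but not on x, so L² convergence makes the averages at
    -- scale k converge uniformly on the boundary.
    (∀ k : ℕ, ∃ b : ℝ, 0 < b ∧ ∀ x ∈ frontier Ω,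
      ENNReal.ofReal b ≤ volume (Metric.ball x (R * (1 / 2) ^ k) ∩ Ω)) ∧
    ∀ u : EuclideanSpace ℝ (Fin N) → ℝ, Measurable u → IntegrableOn u Ω →
      interiorEnergy Ω s p u < ∞ →
      (∀ᵐ x ∂(μ.restrict (frontier Ω)), ∃ a, HasTraceAt Ω u x a) ∧
      ∀ k : ℕ, ∫⁻ x in frontier Ω, ENNReal.ofReal
          (|traceFun Ω u x - ⨍ y in Metric.ball x (R * (1 / 2) ^ k) ∩ Ω, u y| ^ p) ∂μ ≤
        ENNReal.ofReal (C * θ ^ k) * interiorEnergy Ω s p u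
  poincare : ∃ C : ℝ, 0 ≤ C ∧ ∀ (u : EuclideanSpace ℝ (Fin N) → ℝ) (A : ℝ), Measurable u →
    IntegrableOn u Ω → ∫ x in Ω, u x = 0 → 0 ≤ A →
    ∫⁻ y in Ω, ENNReal.ofReal (u y ^ 2) = ENNReal.ofReal (A ^ 2) →
    interiorEnergy Ω s p u < ∞ → A ^ p ≤ C * (interiorEnergy Ω s p u).toReal

/-- The hypothesis `hs` is N - d < sp, needed for traces; `hp` amounts to N/p ≤ N/2 + s, needed for
the embedding into L². -/
theorem isEnergySetting_of_isEpsDeltaDomain {N : ℕ} (hN : 0 < N)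
    {Ω : Set (EuclideanSpace ℝ (Fin N))} (hΩb : Bornology.IsBounded Ω) {ε δ : ℝ}
    (hΩ : IsEpsDeltaDomain ε δ Ω) {μ : Measure (EuclideanSpace ℝ (Fin N))} {d s η p q : ℝ}
    (hΓ : IsDSet d μ (frontier Ω)) (hp₁ : 1 < p) (hq₁ : 1 < q) (hs₀ : 0 < s) (hη₀ : 0 < η)
    (hs : (N - d) / p < s) (hp : 2 * N / (N + 2 * s) ≤ p) : IsEnergySetting Ω μ d s η p q := by
  obtain ⟨-, -, hd, -, -, c₁, c₂, -, hc₂, hμ⟩ := hΓ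
  obtain ⟨c, R, hc, hR, hR1, hdens⟩ := hΩ.exists_measure_density hN
  have hp0 : 0 < p := by linarith
  have hΩo : IsOpen Ω := hΩ.2.2.1
  have hμ₂ := fun x hx r hr hr1 => (hμ x hx r hr hr1).2
  have hcomp : IsCompact (frontier Ω) :=
    hΩb.isCompact_closure.of_isClosed_subset isClosed_frontier frontier_subset_closure
  have hfin := measure_lt_top_of_ahlfors hcomp hμ₂
  have : IsFiniteMeasure (μ.restrict (frontier Ω)) := ⟨by simpa using hfin⟩
  have hN' : (0 : ℝ) < N := Nat.cast_pos.2 hN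
  refine ⟨hΩo, hΩ.2.2.2.1.nonempty, hΩb, hfin, hp₁, hq₁, hs₀, by positivity, ?_, ?_⟩
  · obtain ⟨C, θ, hC, hθ0, hθ1, h⟩ := exists_trace_estimate (μ := μ) (F := frontier Ω) (d := d)
      (c₂ := c₂) hp₁ hs₀ (by rwa [div_lt_iff₀ hp0] at hs) hΩo.measurableSet
      isClosed_frontier.measurableSet frontier_subset_closure hc hc₂ hR hR1 hdens hμ₂
    refine ⟨C, θ, R, hC, hθ0, hθ1, fun k => ⟨c * (R * (1 / 2) ^ k) ^ (N : ℝ), by positivity,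
      fun x hx => hdens x (frontier_subset_closure hx) _ (by positivity) ?_⟩, h⟩
    have : ((1 : ℝ) / 2) ^ k ≤ 1 := pow_le_one₀ (by norm_num) (by norm_num)
    nlinarith
  · refine exists_poincare (c := c) (R := R) (D := Metric.diam Ω) hN hΩo hΩ.2.2.2.1.nonempty
      (fun x hx y hy => ?_) hΩb.measure_lt_top.ne hs₀ hp₁ ?_ hc hR (by linarith)
      fun x hx => hdens x (subset_closure hx)
    · rw [← dist_eq_norm]
      exact Metric.dist_le_diam_of_mem hΩb hx hy
    · rw [div_le_iff₀ (by positivity)] at hp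
      rw [div_le_iff₀ hp0]
      linarith

/-! ### Convexity, translation invariance, coercivity and lower semicontinuity of `Psi` -/

namespace IsEnergySetting

variable {N : ℕ} {Ω : Set (EuclideanSpace ℝ (Fin N))} {μ : Measure (EuclideanSpace ℝ (Fin N))}
  {d s η p q : ℝ}

theorem isFiniteMeasure_restrict (h : IsEnergySetting Ω μ d s η p q) :
    IsFiniteMeasure ((volume : Measure (EuclideanSpace ℝ (Fin N))).restrict Ω) :=
  ⟨by simpa using h.bounded.measure_lt_top⟩

theorem isFiniteMeasure_boundary (h : IsEnergySetting Ω μ d s η p q) :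
    IsFiniteMeasure (μ.restrict (frontier Ω)) := ⟨by simpa using h.boundary_finite⟩

theorem integrableOn (h : IsEnergySetting Ω μ d s η p q)
    (u : Lp ℝ 2 ((volume : Measure (EuclideanSpace ℝ (Fin N))).restrict Ω)) :
    IntegrableOn u Ω :=
  have := h.isFiniteMeasure_restrict
  (Lp.memLp u).integrable one_le_two

theorem ae_hasTraceAt (h : IsEnergySetting Ω μ d s η p q)
    {u : Lp ℝ 2 ((volume : Measure (EuclideanSpace ℝ (Fin N))).restrict Ω)}
    (hu : interiorEnergy Ω s p u < ∞) :
    ∀ᵐ x ∂(μ.restrict (frontier Ω)), ∃ a, HasTraceAt Ω u x a := by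
  obtain ⟨C, θ, R, -, -, -, -, ht⟩ := h.trace
  exact (ht u (Lp.stronglyMeasurable u).measurable (h.integrableOn u) hu).1

theorem aemeasurable_trace (h : IsEnergySetting Ω μ d s η p q)
    {u : Lp ℝ 2 ((volume : Measure (EuclideanSpace ℝ (Fin N))).restrict Ω)}
    (hu : interiorEnergy Ω s p u < ∞) : AEMeasurable (traceFun Ω u) (μ.restrict (frontier Ω)) :=
  aemeasurable_traceFun h.isOpen.measurableSet (Lp.stronglyMeasurable u).measurable
    (h.ae_hasTraceAt hu)

/-- On `L²(Ω)` the membership conditions in the definition of `Psi` follow from the finiteness of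
the two energies. -/
theorem psi_eq (h : IsEnergySetting Ω μ d s η p q)
    (u : Lp ℝ 2 ((volume : Measure (EuclideanSpace ℝ (Fin N))).restrict Ω)) :
    Psi Ω μ d s η p q u = ENNReal.ofReal (1 / p) * interiorEnergy Ω s p u +
      ENNReal.ofReal (1 / q) * besovEnergy (frontier Ω) μ d η q (traceFun Ω u) := by
  have := h.isFiniteMeasure_restrict
  have := h.isFiniteMeasure_boundary
  have hp := h.one_lt_p
  have hq := h.one_lt_q
  have hs := h.s_pos
  unfold Psi
  split_ifs with hmem
  · rfl
  have hp0 : ENNReal.ofReal (1 / p) ≠ 0 := by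
    rw [Ne, ENNReal.ofReal_eq_zero, not_le]
    positivity
  have hq0 : ENNReal.ofReal (1 / q) ≠ 0 := by
    rw [Ne, ENNReal.ofReal_eq_zero, not_le]
    positivity
  by_cases hE : interiorEnergy Ω s p u = ∞
  · rw [hE, ENNReal.mul_top hp0, top_add]
  by_cases hB : besovEnergy (frontier Ω) μ d η q (traceFun Ω u) = ∞
  · rw [hB, ENNReal.mul_top hq0, add_top]
  have hE' : interiorEnergy Ω s p u < ∞ := lt_top_iff_ne_top.2 hE
  have hB' : besovEnergy (frontier Ω) μ d η q (traceFun Ω u) < ∞ := lt_top_iff_ne_top.2 hB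
  refine absurd ⟨⟨?_, hE'⟩, h.ae_hasTraceAt hE', ?_, hB'⟩ hmem
  · refine memLp_of_gagliardo_lt_top (S := Ω) (R := Metric.diam Ω) (by linarith) (by positivity)
      (Lp.stronglyMeasurable u).measurable.aemeasurable
      (ae_restrict_mem h.isOpen.measurableSet) (fun x hx y hy => ?_) hE'
    rw [← dist_eq_norm]
    exact Metric.dist_le_diam_of_mem h.bounded hx hy
  · refine memLp_of_gagliardo_lt_top (S := frontier Ω) (R := Metric.diam (closure Ω))
      (by linarith) h.exponent_nonneg (h.aemeasurable_trace hE')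
      (ae_restrict_mem isClosed_frontier.measurableSet) (fun x hx y hy => ?_) hB'
    rw [← dist_eq_norm]
    exact Metric.dist_le_diam_of_mem h.bounded.closure (frontier_subset_closure hx)
      (frontier_subset_closure hy)

theorem interiorEnergy_le_psi (h : IsEnergySetting Ω μ d s η p q)
    (u : Lp ℝ 2 ((volume : Measure (EuclideanSpace ℝ (Fin N))).restrict Ω)) :
    interiorEnergy Ω s p u ≤ ENNReal.ofReal p * Psi Ω μ d s η p q u := by
  have hp := h.one_lt_p
  rw [h.psi_eq, mul_add, ← mul_assoc, ← ENNReal.ofReal_mul (by linarith),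
    mul_one_div_cancel (by linarith), ENNReal.ofReal_one, one_mul]
  exact le_self_add

theorem interiorEnergy_lt_top (h : IsEnergySetting Ω μ d s η p q)
    {u : Lp ℝ 2 ((volume : Measure (EuclideanSpace ℝ (Fin N))).restrict Ω)}
    (hu : Psi Ω μ d s η p q u < ∞) : interiorEnergy Ω s p u < ∞ :=
  (h.interiorEnergy_le_psi u).trans_lt (ENNReal.mul_lt_top ENNReal.ofReal_lt_top hu)

theorem psi_eq_zero_of_ae_const (h : IsEnergySetting Ω μ d s η p q)
    {u : Lp ℝ 2 ((volume : Measure (EuclideanSpace ℝ (Fin N))).restrict Ω)} {c : ℝ}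
    (hu : ∀ᵐ x ∂(volume.restrict Ω), u x = c) : Psi Ω μ d s η p q u = 0 := by
  have hp := h.one_lt_p
  have hq := h.one_lt_q
  have hu' : u =ᵐ[volume.restrict Ω] fun _ => c := hu
  have h1 : interiorEnergy Ω s p u = 0 := by
    unfold interiorEnergy
    rw [gagliardo_congr hu', gagliardo_const (by linarith)]
  have h2 : besovEnergy (frontier Ω) μ d η q (traceFun Ω u) = 0 := by
    have h3 : traceFun Ω u =ᵐ[μ.restrict (frontier Ω)] fun _ => c := by
      rw [traceFun_congr hu']
      filter_upwards [ae_restrict_mem isClosed_frontier.measurableSet] with x hx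
      exact (hasTraceAt_const h.isOpen (frontier_subset_closure hx) c).traceFun_eq
    unfold besovEnergy
    rw [gagliardo_congr h3, gagliardo_const (by linarith)]
  rw [h.psi_eq, h1, h2, mul_zero, mul_zero, add_zero]

theorem ae_const_of_psi_eq_zero (h : IsEnergySetting Ω μ d s η p q)
    {u : Lp ℝ 2 ((volume : Measure (EuclideanSpace ℝ (Fin N))).restrict Ω)}
    (hu : Psi Ω μ d s η p q u = 0) : ∃ c : ℝ, ∀ᵐ x ∂(volume.restrict Ω), u x = c := by
  have h1 := h.interiorEnergy_le_psi u
  rw [hu, mul_zero, nonpos_iff_eq_zero] at h1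
  exact ae_const_of_gagliardo_eq_zero (Lp.stronglyMeasurable u).measurable h1

theorem coeFn_linear_combination {ν : Measure (EuclideanSpace ℝ (Fin N))} (u v : Lp ℝ 2 ν)
    (α β : ℝ) : ⇑(α • u + β • v) =ᵐ[ν] fun x => α * u x + β * v x := by
  filter_upwards [Lp.coeFn_add (α • u) (β • v), Lp.coeFn_smul α u, Lp.coeFn_smul β v]
    with x h1 h2 h3
  rw [h1, Pi.add_apply, h2, h3]
  rfl

theorem traceFun_linear_combination (h : IsEnergySetting Ω μ d s η p q)
    {u v : Lp ℝ 2 ((volume : Measure (EuclideanSpace ℝ (Fin N))).restrict Ω)}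
    (hu : interiorEnergy Ω s p u < ∞) (hv : interiorEnergy Ω s p v < ∞) (α β : ℝ) :
    traceFun Ω (α • u + β • v : Lp ℝ 2 ((volume : Measure (EuclideanSpace ℝ (Fin N))).restrict Ω))
      =ᵐ[μ.restrict (frontier Ω)] fun x => α * traceFun Ω u x + β * traceFun Ω v x := by
  rw [traceFun_congr (coeFn_linear_combination u v α β)]
  filter_upwards [h.ae_hasTraceAt hu, h.ae_hasTraceAt hv] with x ⟨a, ha⟩ ⟨b, hb⟩
  rw [ha.traceFun_eq, hb.traceFun_eq]
  exact (ha.linear_combination hb (h.integrableOn u) (h.integrableOn v) α β).traceFun_eq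

theorem interiorEnergy_convex (h : IsEnergySetting Ω μ d s η p q)
    (u v : Lp ℝ 2 ((volume : Measure (EuclideanSpace ℝ (Fin N))).restrict Ω)) {α β : ℝ}
    (hα : 0 ≤ α) (hβ : 0 ≤ β) (hαβ : α + β = 1) :
    interiorEnergy Ω s p
      (α • u + β • v : Lp ℝ 2 ((volume : Measure (EuclideanSpace ℝ (Fin N))).restrict Ω)) ≤
      ENNReal.ofReal α * interiorEnergy Ω s p u + ENNReal.ofReal β * interiorEnergy Ω s p v := by
  unfold interiorEnergy
  rw [gagliardo_congr (coeFn_linear_combination u v α β)]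
  exact gagliardo_convex h.one_lt_p.le (Lp.stronglyMeasurable u).measurable.aemeasurable
    (Lp.stronglyMeasurable v).measurable.aemeasurable hα hβ hαβ

theorem interiorEnergy_neg
    (u : Lp ℝ 2 ((volume : Measure (EuclideanSpace ℝ (Fin N))).restrict Ω)) :
    interiorEnergy Ω s p
      (-u : Lp ℝ 2 ((volume : Measure (EuclideanSpace ℝ (Fin N))).restrict Ω)) =
      interiorEnergy Ω s p u := by
  unfold interiorEnergy
  rw [gagliardo_congr (Lp.coeFn_neg u)]
  exact gagliardo_neg

theorem psi_convex (h : IsEnergySetting Ω μ d s η p q)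
    (u v : Lp ℝ 2 ((volume : Measure (EuclideanSpace ℝ (Fin N))).restrict Ω)) (α β : ℝ)
    (hα : 0 ≤ α) (hβ : 0 ≤ β) (hαβ : α + β = 1) :
    Psi Ω μ d s η p q (α • u + β • v) ≤
      ENNReal.ofReal α * Psi Ω μ d s η p q u + ENNReal.ofReal β * Psi Ω μ d s η p q v := by
  have := h.isFiniteMeasure_boundary
  -- Zero weights are treated apart, since 0 · ∞ = 0 would defeat the reduction to finite energies,
  -- on which linearity of the trace depends.
  rcases hα.eq_or_lt with rfl | hα0
  · rw [zero_add] at hαβ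
    subst hαβ
    simp
  rcases hβ.eq_or_lt with rfl | hβ0
  · rw [add_zero] at hαβ
    subst hαβ
    simp
  by_cases hu : Psi Ω μ d s η p q u = ∞
  · rw [hu, ENNReal.mul_top (by simpa using hα0), top_add]
    exact le_top
  by_cases hv : Psi Ω μ d s η p q v = ∞
  · rw [hv, ENNReal.mul_top (by simpa using hβ0), add_top]
    exact le_top
  have hEu := h.interiorEnergy_lt_top (lt_top_iff_ne_top.2 hu)
  have hEv := h.interiorEnergy_lt_top (lt_top_iff_ne_top.2 hv)
  have h1 := h.interiorEnergy_convex u v hα hβ hαβ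
  have h2 : besovEnergy (frontier Ω) μ d η q (traceFun Ω
      (α • u + β • v : Lp ℝ 2 ((volume : Measure (EuclideanSpace ℝ (Fin N))).restrict Ω))) ≤
      ENNReal.ofReal α * besovEnergy (frontier Ω) μ d η q (traceFun Ω u) +
      ENNReal.ofReal β * besovEnergy (frontier Ω) μ d η q (traceFun Ω v) := by
    unfold besovEnergy
    rw [gagliardo_congr (h.traceFun_linear_combination hEu hEv α β)]
    exact gagliardo_convex h.one_lt_q.le (h.aemeasurable_trace hEu) (h.aemeasurable_trace hEv)
      hα hβ hαβ
  rw [h.psi_eq, h.psi_eq, h.psi_eq]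
  refine (add_le_add (mul_le_mul_right h1 _) (mul_le_mul_right h2 _)).trans (le_of_eq ?_)
  ring

theorem psi_add_const (h : IsEnergySetting Ω μ d s η p q)
    {u v : Lp ℝ 2 ((volume : Measure (EuclideanSpace ℝ (Fin N))).restrict Ω)} {c : ℝ}
    (hv : v =ᵐ[volume.restrict Ω] fun x => u x + c) :
    Psi Ω μ d s η p q v = Psi Ω μ d s η p q u := by
  have := h.isFiniteMeasure_restrict
  have hE : interiorEnergy Ω s p v = interiorEnergy Ω s p u := by
    unfold interiorEnergy
    rw [gagliardo_congr hv, gagliardo_add_const]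
  rw [h.psi_eq, h.psi_eq, hE]
  by_cases hfin : interiorEnergy Ω s p u = ∞
  -- With infinite interior energy the trace may fail to exist, but both sides are then infinite
  -- whatever the boundary term.
  · have hp0 : ENNReal.ofReal (1 / p) ≠ 0 := by
      rw [Ne, ENNReal.ofReal_eq_zero, not_le]
      have := h.one_lt_p
      positivity
    rw [hfin, ENNReal.mul_top hp0, top_add, top_add]
  have hB : traceFun Ω v =ᵐ[μ.restrict (frontier Ω)] fun x => traceFun Ω u x + c := by
    rw [traceFun_congr hv]
    filter_upwards [h.ae_hasTraceAt (lt_top_iff_ne_top.2 hfin),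
      ae_restrict_mem isClosed_frontier.measurableSet] with x ⟨a, ha⟩ hx
    have h1 := ha.linear_combination (hasTraceAt_const h.isOpen (frontier_subset_closure hx) c)
      (h.integrableOn u) (integrable_const c) 1 1
    simp only [one_mul] at h1
    rw [h1.traceFun_eq, ha.traceFun_eq]
  unfold besovEnergy
  rw [gagliardo_congr hB, gagliardo_add_const]

theorem lintegral_sq_eq {ν : Measure (EuclideanSpace ℝ (Fin N))} (u : Lp ℝ 2 ν) :
    ∫⁻ x, ENNReal.ofReal (u x ^ 2) ∂ν = ENNReal.ofReal (‖u‖ ^ 2) := by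
  have h1 : ‖u‖ ^ 2 = ∫ x, u x ^ 2 ∂ν := by
    rw [← real_inner_self_eq_norm_sq, L2.inner_def]
    simp [pow_two]
  rw [h1, ofReal_integral_eq_lintegral_ofReal (Lp.memLp u).integrable_sq
    (Eventually.of_forall fun x => sq_nonneg _)]

theorem psi_coercive (h : IsEnergySetting Ω μ d s η p q) :
    ∃ C : ℝ, 0 ≤ C ∧ ∀ u : Lp ℝ 2 ((volume : Measure (EuclideanSpace ℝ (Fin N))).restrict Ω),
      ∫ x in Ω, u x = 0 → Psi Ω μ d s η p q u < ∞ →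
      ‖u‖ ^ p ≤ C * (Psi Ω μ d s η p q u).toReal := by
  obtain ⟨C, hC, hpoin⟩ := h.poincare
  have hp := h.one_lt_p
  refine ⟨C * p, by positivity, fun u hmean hu => ?_⟩
  have h1 := hpoin u ‖u‖ (Lp.stronglyMeasurable u).measurable (h.integrableOn u) hmean
    (norm_nonneg u) (lintegral_sq_eq u) (h.interiorEnergy_lt_top hu)
  have h2 := ENNReal.toReal_mono (ENNReal.mul_lt_top ENNReal.ofReal_lt_top hu).ne
    (h.interiorEnergy_le_psi u)
  rw [ENNReal.toReal_mul, ENNReal.toReal_ofReal (by linarith)] at h2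
  rw [mul_assoc]
  exact h1.trans (mul_le_mul_of_nonneg_left h2 hC)

/-- The trace is continuous in measure along energy-bounded sequences converging in `L²`. -/
theorem tendsto_measure_trace (h : IsEnergySetting Ω μ d s η p q)
    {w : ℕ → Lp ℝ 2 ((volume : Measure (EuclideanSpace ℝ (Fin N))).restrict Ω)}
    (hw : Tendsto w atTop (𝓝 0)) {L : ℝ≥0∞} (hL : L < ∞) (hwL : ∀ n, interiorEnergy Ω s p (w n) ≤ L)
    {e : ℝ} (he : 0 < e) :
    Tendsto (fun n => μ.restrict (frontier Ω) {x | e ≤ |traceFun Ω (w n) x|}) atTop (𝓝 0) := by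
  obtain ⟨C, θ, R, hC, hθ0, hθ1, hdens, htr⟩ := h.trace
  have hp := h.one_lt_p
  have hE : ∀ n, interiorEnergy Ω s p (w n) < ∞ := fun n => (hwL n).trans_lt hL
  set m : ℕ → ℕ → EuclideanSpace ℝ (Fin N) → ℝ := fun k n x =>
    ⨍ y in Metric.ball x (R * (1 / 2) ^ k) ∩ Ω, w n y with hm
  have hmm : ∀ k n, Measurable (m k n) := fun k n =>
    measurable_ball_average h.isOpen.measurableSet (Lp.stronglyMeasurable (w n)).measurable _
  have he2 : 0 < (e / 2) ^ p := by positivity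
  -- Chebyshev's inequality applied to trace minus average: the bound is uniform in n and tends to
  -- zero with k. Afterwards k is fixed and n tends to infinity.
  have hfar : ∀ k n, μ.restrict (frontier Ω) {x | e / 2 ≤ |traceFun Ω (w n) x - m k n x|} ≤
      ENNReal.ofReal (C * θ ^ k) * L / ENNReal.ofReal ((e / 2) ^ p) := by
    intro k n
    have h1 : {x | e / 2 ≤ |traceFun Ω (w n) x - m k n x|} ⊆
        {x | ENNReal.ofReal ((e / 2) ^ p) ≤
          ENNReal.ofReal (|traceFun Ω (w n) x - m k n x| ^ p)} := fun x hx => by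
      have hx' : e / 2 ≤ |traceFun Ω (w n) x - m k n x| := hx
      exact ENNReal.ofReal_le_ofReal (Real.rpow_le_rpow (by positivity) hx' (by linarith))
    have hmeas : AEMeasurable (fun x => ENNReal.ofReal (|traceFun Ω (w n) x - m k n x| ^ p))
        (μ.restrict (frontier Ω)) := by
      have h2 := h.aemeasurable_trace (hE n)
      have h3 := (hmm k n).aemeasurable (μ := μ.restrict (frontier Ω))
      exact ((measurable_norm.comp_aemeasurable (h2.sub h3)).pow_const p).ennreal_ofReal
    refine (measure_mono h1).trans ((meas_ge_le_lintegral_div hmeas (by simpa using he2)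
      ENNReal.ofReal_ne_top).trans ?_)
    gcongr
    refine ((htr (w n) (Lp.stronglyMeasurable (w n)).measurable (h.integrableOn (w n))
      (hE n)).2 k).trans ?_
    gcongr
    exact hwL n
  have hlim : Tendsto (fun k : ℕ => ENNReal.ofReal (C * θ ^ k) * L / ENNReal.ofReal ((e / 2) ^ p))
      atTop (𝓝 0) := by
    have h1 : Tendsto (fun k : ℕ => ENNReal.ofReal (C * θ ^ k)) atTop (𝓝 0) := by
      have h2 := ENNReal.tendsto_ofReal
        ((tendsto_pow_atTop_nhds_zero_of_lt_one hθ0.le hθ1).const_mul C)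
      simpa using h2
    have h3 := ENNReal.Tendsto.mul_const h1 (b := L) (Or.inr hL.ne)
    have h4 := ENNReal.Tendsto.div_const h3 (b := ENNReal.ofReal ((e / 2) ^ p))
      (Or.inr (by simpa using he2))
    simpa using h4
  rw [ENNReal.tendsto_nhds_zero]
  intro t ht
  obtain ⟨k, hk⟩ := (ENNReal.tendsto_nhds_zero.1 hlim t ht).exists
  obtain ⟨b, hb, hbd⟩ := hdens k
  have hsmall : ∀ᶠ n in atTop, b⁻¹ * ‖w n‖ ^ 2 < (e / 2) ^ 2 := by
    have h1 : Tendsto (fun n => b⁻¹ * ‖w n‖ ^ 2) atTop (𝓝 0) := by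
      simpa using ((hw.norm).pow 2).const_mul b⁻¹
    exact (tendsto_order.1 h1).2 _ (by positivity)
  filter_upwards [hsmall] with n hn
  refine le_trans (measure_mono_ae ?_) ((hfar k n).trans hk)
  filter_upwards [ae_restrict_mem isClosed_frontier.measurableSet] with x hx hxe
  have hxe' : e ≤ |traceFun Ω (w n) x| := hxe
  have h1 : |m k n x| ^ 2 ≤ b⁻¹ * ‖w n‖ ^ 2 :=
    abs_setAverage_sq_le h.bounded.measure_lt_top.ne (h.integrableOn (w n)) inter_subset_right
      hb (hbd x hx) (lintegral_sq_eq (w n))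
  have h2 : |m k n x| < e / 2 := lt_of_pow_lt_pow_left₀ 2 (by positivity) (h1.trans_lt hn)
  have h3 : |traceFun Ω (w n) x| ≤ |traceFun Ω (w n) x - m k n x| + |m k n x| := by
    simpa using abs_add_le (traceFun Ω (w n) x - m k n x) (m k n x)
  show e / 2 ≤ |traceFun Ω (w n) x - m k n x|
  linarith

/-- Fatou gives the interior term and shows that v itself has finite interior energy, hence a trace.
Traces of the sequence converge to it in measure, so a further subsequence makes Fatou applicable on
the boundary. -/
theorem psi_lsc (h : IsEnergySetting Ω μ d s η p q)
    (u : ℕ → Lp ℝ 2 ((volume : Measure (EuclideanSpace ℝ (Fin N))).restrict Ω))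
    (v : Lp ℝ 2 ((volume : Measure (EuclideanSpace ℝ (Fin N))).restrict Ω)) (M : ℝ)
    (huv : Tendsto u atTop (𝓝 v)) (hM : ∀ n, Psi Ω μ d s η p q (u n) ≤ ENNReal.ofReal M) :
    Psi Ω μ d s η p q v ≤ ENNReal.ofReal M := by
  have := h.isFiniteMeasure_boundary
  have hp := h.one_lt_p
  have hq := h.one_lt_q
  set L := ENNReal.ofReal p * ENNReal.ofReal M with hL
  have hLtop : L < ∞ := ENNReal.mul_lt_top ENNReal.ofReal_lt_top ENNReal.ofReal_lt_top
  have hEu : ∀ n, interiorEnergy Ω s p (u n) ≤ L := fun n =>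
    (h.interiorEnergy_le_psi (u n)).trans (mul_le_mul_right (hM n) _)
  obtain ⟨ns, hns, hae⟩ := (tendstoInMeasure_of_tendsto_Lp huv).exists_seq_tendsto_ae
  have hmu : ∀ n, AEMeasurable (u n) (volume.restrict Ω) := fun n =>
    (Lp.stronglyMeasurable (u n)).measurable.aemeasurable
  have hEv : interiorEnergy Ω s p v ≤ L := by
    refine (gagliardo_le_liminf (by linarith) (fun k => hmu (ns k)) hae).trans ?_
    exact (liminf_le_liminf (Eventually.of_forall fun k => hEu (ns k))).trans_eq (liminf_const L)
  -- The half-difference is a convex combination of u and -v, so convexity bounds its energy by the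
  -- same L.
  set w : ℕ → Lp ℝ 2 ((volume : Measure (EuclideanSpace ℝ (Fin N))).restrict Ω) := fun k =>
    (1 / 2 : ℝ) • u (ns k) + (1 / 2 : ℝ) • (-v) with hw
  have hw0 : Tendsto w atTop (𝓝 0) := by
    have h1 := ((huv.comp hns.tendsto_atTop).const_smul (1 / 2 : ℝ)).add
      (tendsto_const_nhds (x := (1 / 2 : ℝ) • (-v)))
    have e : (1 / 2 : ℝ) • v + (1 / 2 : ℝ) • (-v) = 0 := by simp
    rwa [e] at h1
  have hnegv : interiorEnergy Ω s p
      (-v : Lp ℝ 2 ((volume : Measure (EuclideanSpace ℝ (Fin N))).restrict Ω)) ≤ L :=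
    (interiorEnergy_neg v).trans_le hEv
  have hwL : ∀ k, interiorEnergy Ω s p (w k) ≤ L := by
    intro k
    refine (h.interiorEnergy_convex (u (ns k)) (-v) (by norm_num) (by norm_num)
      (by norm_num)).trans ((add_le_add (mul_le_mul_right (hEu (ns k)) _)
      (mul_le_mul_right hnegv _)).trans (le_of_eq ?_))
    rw [← add_mul, ← ENNReal.ofReal_add (by norm_num) (by norm_num)]
    norm_num
  have htrw : ∀ k, traceFun Ω (w k) =ᵐ[μ.restrict (frontier Ω)] fun x =>
      1 / 2 * (traceFun Ω (u (ns k)) x - traceFun Ω v x) := by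
    intro k
    have e : w k = (1 / 2 : ℝ) • u (ns k) + (-1 / 2 : ℝ) • v := by
      simp only [hw, smul_neg, neg_div, neg_smul]
    rw [e]
    filter_upwards [h.traceFun_linear_combination ((hEu (ns k)).trans_lt hLtop)
      (hEv.trans_lt hLtop) (1 / 2) (-1 / 2)] with x hx
    rw [hx]
    ring
  have hmeas : TendstoInMeasure (μ.restrict (frontier Ω)) (fun k => traceFun Ω (u (ns k))) atTop
      (traceFun Ω v) := by
    rw [tendstoInMeasure_iff_norm]
    intro e he
    refine (h.tendsto_measure_trace hw0 hLtop hwL (half_pos he)).congr fun k => ?_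
    refine measure_congr ?_
    filter_upwards [htrw k] with x hx
    refine propext ?_
    change e / 2 ≤ |traceFun Ω (w k) x| ↔ e ≤ |traceFun Ω (u (ns k)) x - traceFun Ω v x|
    rw [hx, abs_mul, abs_of_pos (by norm_num : (0 : ℝ) < 1 / 2)]
    constructor <;> intro <;> linarith
  obtain ⟨ms, hms, hae'⟩ := hmeas.exists_seq_tendsto_ae
  have h1 : interiorEnergy Ω s p v ≤
      liminf (fun j => interiorEnergy Ω s p (u (ns (ms j)))) atTop :=
    gagliardo_le_liminf (by linarith) (fun j => hmu (ns (ms j)))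
      (hae.mono fun x hx => hx.comp hms.tendsto_atTop)
  have h2 : besovEnergy (frontier Ω) μ d η q (traceFun Ω v) ≤
      liminf (fun j => besovEnergy (frontier Ω) μ d η q (traceFun Ω (u (ns (ms j))))) atTop :=
    gagliardo_le_liminf (by linarith)
      (fun j => h.aemeasurable_trace ((hEu (ns (ms j))).trans_lt hLtop)) hae'
  rw [h.psi_eq]
  refine (add_le_add (mul_le_mul_right h1 _) (mul_le_mul_right h2 _)).trans ?_
  refine mul_liminf_add_mul_liminf_le fun j => ?_
  rw [← h.psi_eq]
  exact hM _

end IsEnergySetting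

/-! ### The subdifferential of the energy functional -/

/-- Competitors of infinite value satisfy the inequality trivially, which leaves a real inequality
on the effective domain. -/
theorem mem_subdifferential_iff {H : Type*} [NormedAddCommGroup H] [InnerProductSpace ℝ H]
    {φ : H → ℝ≥0∞} {u f : H} : f ∈ subdifferential φ u ↔
      φ u < ∞ ∧ ∀ v, φ v < ∞ → (φ u).toReal + inner ℝ f (v - u) ≤ (φ v).toReal := by
  refine and_congr_right fun hu => forall_congr' fun v => ?_
  rw [← EReal.coe_ennreal_toReal hu.ne]
  rcases eq_or_ne (φ v) ∞ with hv | hv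
  · simp [hv]
  · rw [← EReal.coe_ennreal_toReal hv, ← EReal.coe_add, EReal.coe_le_coe_iff]
    simp [lt_top_iff_ne_top, hv]

section Constants

variable {X : Type*} [MeasurableSpace X] {ν : Measure X} [IsFiniteMeasure ν]

theorem inner_Lp_const (c : ℝ) (f : Lp ℝ 2 ν) :
    inner ℝ (Lp.const 2 ν c) f = c * ∫ x, f x ∂ν := by
  rw [L2.inner_def, ← integral_const_mul]
  refine integral_congr_ae ?_
  filter_upwards [Lp.coeFn_const 2 ν c] with x hx
  rw [hx]
  simp [mul_comm]

theorem coeFn_add_Lp_const (u : Lp ℝ 2 ν) (c : ℝ) :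
    ⇑(u + Lp.const 2 ν c) =ᵐ[ν] fun x => u x + c := by
  filter_upwards [Lp.coeFn_add u (Lp.const 2 ν c), Lp.coeFn_const 2 ν c] with x h1 h2
  rw [h1, Pi.add_apply, h2]
  rfl

end Constants

/-! ### Null space, range and orthogonal complement -/

namespace IsEnergySetting

variable {N : ℕ} {Ω : Set (EuclideanSpace ℝ (Fin N))} {μ : Measure (EuclideanSpace ℝ (Fin N))}
  {d s η p q : ℝ}

theorem psi_add_Lp_const (h : IsEnergySetting Ω μ d s η p q)
    [IsFiniteMeasure ((volume : Measure (EuclideanSpace ℝ (Fin N))).restrict Ω)]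
    (u : Lp ℝ 2 ((volume : Measure (EuclideanSpace ℝ (Fin N))).restrict Ω)) (c : ℝ) :
    Psi Ω μ d s η p q (u + Lp.const 2 _ c) = Psi Ω μ d s η p q u :=
  h.psi_add_const (coeFn_add_Lp_const u c)

theorem psi_zero (h : IsEnergySetting Ω μ d s η p q) : Psi Ω μ d s η p q 0 = 0 :=
  h.psi_eq_zero_of_ae_const (c := 0) (Lp.coeFn_zero _ _ _)

theorem nullSpace_opA (h : IsEnergySetting Ω μ d s η p q) :
    nullSpace (opA Ω μ d s η p q) = {u | ∃ c : ℝ, ∀ᵐ x ∂(volume.restrict Ω), u x = c} := by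
  ext u
  simp only [nullSpace, opA, mem_ofPred_eq, mem_subdifferential_iff, inner_zero_left, add_zero]
  constructor
  · rintro ⟨hu, hmin⟩
    have h1 := hmin 0 (by simp [h.psi_zero])
    rw [h.psi_zero, ENNReal.toReal_zero] at h1
    refine h.ae_const_of_psi_eq_zero ?_
    exact ((ENNReal.toReal_eq_zero_iff _).1 (le_antisymm h1 ENNReal.toReal_nonneg)).resolve_right
      hu.ne
  · rintro ⟨c, hc⟩
    simp [h.psi_eq_zero_of_ae_const hc]

theorem integral_eq_zero_of_mem_opA (h : IsEnergySetting Ω μ d s η p q)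
    {u f : Lp ℝ 2 ((volume : Measure (EuclideanSpace ℝ (Fin N))).restrict Ω)}
    (hf : f ∈ opA Ω μ d s η p q u) : ∫ x in Ω, f x = 0 := by
  have := h.isFiniteMeasure_restrict
  obtain ⟨hu, hmin⟩ := mem_subdifferential_iff.1 hf
  have key : ∀ c : ℝ, c * ∫ x in Ω, f x ≤ 0 := by
    intro c
    have h1 := hmin (u + Lp.const 2 _ c) (by rwa [h.psi_add_Lp_const])
    rw [h.psi_add_Lp_const, add_sub_cancel_left, real_inner_comm, inner_Lp_const] at h1
    linarith
  have h1 := key 1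
  have h2 := key (-1)
  linarith

theorem exists_mem_opA (h : IsEnergySetting Ω μ d s η p q)
    {f : Lp ℝ 2 ((volume : Measure (EuclideanSpace ℝ (Fin N))).restrict Ω)}
    (hf : ∫ x in Ω, f x = 0) : ∃ u, f ∈ opA Ω μ d s η p q u := by
  have := h.isFiniteMeasure_restrict
  set e := Lp.const 2 ((volume : Measure (EuclideanSpace ℝ (Fin N))).restrict Ω) (1 : ℝ) with he
  set V := (volume Ω).toReal with hV
  have hV0 : V ≠ 0 := (ENNReal.toReal_pos (h.isOpen.measure_pos _ h.nonempty).ne'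
    h.bounded.measure_lt_top.ne).ne'
  have hK : ∀ v, v ∈ (ℝ ∙ e)ᗮ ↔ ∫ x in Ω, v x = 0 := fun v => by
    rw [Submodule.mem_orthogonal_singleton_iff_inner_right, he, inner_Lp_const, one_mul]
  obtain ⟨C, hC, hcoer⟩ := h.psi_coercive
  obtain ⟨u, -, hu, hmin⟩ := exists_minimiser_of_coercive h.psi_zero h.psi_convex h.psi_lsc
    (ℝ ∙ e)ᗮ (Submodule.isClosed_orthogonal _) h.one_lt_p hC
    (fun v hv hfin => hcoer v ((hK v).1 hv) hfin) f
  refine ⟨u, mem_subdifferential_iff.2 ⟨hu, fun v hv => ?_⟩⟩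
  -- Minus the mean of v, so that v + c is an admissible competitor; `hf` makes the pairing of f
  -- with the constant vanish.
  set c : ℝ := -((∫ x in Ω, v x) / V) with hc
  have hmem : v + Lp.const 2 _ c ∈ (ℝ ∙ e)ᗮ := by
    rw [hK, integral_congr_ae (coeFn_add_Lp_const v c),
      integral_add (h.integrableOn v) (integrable_const c), setIntegral_const, hc, measureReal_def,
      ← hV, smul_eq_mul]
    field_simp
    ring
  have h1 := hmin (v + Lp.const 2 _ c) hmem (by rwa [h.psi_add_Lp_const])
  have h2 : inner ℝ f (v + Lp.const 2 _ c - u) = inner ℝ f (v - u) := by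
    have h3 : inner ℝ f (Lp.const 2 _ c) = 0 := by
      rw [real_inner_comm, inner_Lp_const, hf, mul_zero]
    rw [add_sub_right_comm, inner_add_right, h3, add_zero]
  rwa [h.psi_add_Lp_const, h2] at h1

theorem rangeSpace_opA (h : IsEnergySetting Ω μ d s η p q) :
    rangeSpace (opA Ω μ d s η p q) = {f | ∫ x in Ω, f x = 0} :=
  Set.ext fun _ => ⟨fun ⟨_, hu⟩ => h.integral_eq_zero_of_mem_opA hu, fun hf => h.exists_mem_opA hf⟩

theorem orthComplement_nullSpace_opA (h : IsEnergySetting Ω μ d s η p q) :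
    orthComplement (nullSpace (opA Ω μ d s η p q)) = {f | ∫ x in Ω, f x = 0} := by
  have := h.isFiniteMeasure_restrict
  rw [h.nullSpace_opA]
  ext f
  constructor
  · intro hf
    have h1 := hf (Lp.const 2 _ 1) ⟨1, Lp.coeFn_const 2 _ 1⟩
    rwa [inner_Lp_const, one_mul] at h1
  · rintro hf u ⟨c, hc⟩
    have h1 : u = Lp.const 2 _ c := Lp.ext (by
      filter_upwards [hc, Lp.coeFn_const 2 (volume.restrict Ω) c] with x h1 h2
      rw [h1, h2]
      rfl)
    have hf' : ∫ x in Ω, f x = 0 := hf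
    rw [h1, inner_Lp_const, hf', mul_zero]

end IsEnergySetting

theorem theorem6p4 (N : ℕ) (hN : 2 ≤ N) (Ω : Set (EuclideanSpace ℝ (Fin N)))
    (hΩb : Bornology.IsBounded Ω) (ε δ : ℝ) (hΩ : IsEpsDeltaDomain ε δ Ω)
    (hΩL : IsIncreasingUnionOfLipschitz Ω)
    (μ : Measure (EuclideanSpace ℝ (Fin N))) (d s η p q : ℝ)
    (hΓ : IsDSet d μ (frontier Ω)) (hd₁ : N - p < d) (hd₂ : d < N)
    (hp₁ : 1 < p) (hp₂ : p < N) (hq₁ : 1 < q) (hq₂ : q < d)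
    (hs₀ : 0 < s) (hs₁ : s < 1) (hη₀ : 0 < η) (hη₁ : η < 1) (hs : (N - d) / p < s)
    (hp : 2 * N / (N + 2 * s) ≤ p) (hq : 2 * d / (d + 2 * η) ≤ q) :
    nullSpace (opA Ω μ d s η p q)
        = {u | ∃ c : ℝ, ∀ᵐ x ∂(volume.restrict Ω), u x = c} ∧
    rangeSpace (opA Ω μ d s η p q) = {f | ∫ x in Ω, f x = 0} ∧
    rangeSpace (opA Ω μ d s η p q) = orthComplement (nullSpace (opA Ω μ d s η p q)) := by
  have h : IsEnergySetting Ω μ d s η p q :=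
    isEnergySetting_of_isEpsDeltaDomain (by omega) hΩb hΩ hΓ hp₁ hq₁ hs₀ hη₀ hs hp
  exact ⟨h.nullSpace_opA, h.rangeSpace_opA,
    h.rangeSpace_opA.trans h.orthComplement_nullSpace_opA.symm⟩
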